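/- **Theorem (Uniqueness of the Inner Product).** Let $n\ge 0$ be an integer and $q>0$ a real number. *Setting.* A *diagram* is a noncrossing perfect pairing of $\{1,\dots,2n\}$. The Temperley–Lieb algebra $TL_n=TL_n(q)$ has as basis the elements $e_{\mathfrak p}$ indexed by the diagrams $\mathfrak p$. The transpose $\mathfrak p^t$ is obtained from $\mathfrak p$ by relabelling each point $i$ as $2n-i+1$ (left-right flip), and $*$ is the conjugate-linear map on $TL_n$ with $e_{\mathfrak p}^*=e_{\mathfrak p^t}$. A *half-diagram* is a partition of $\{1,\dots,n\}$ into pairs and singletons (the singletons are called through-strings) with no two pairs crossing and no through-string lying strictly between the two points of a pair. $U(n)$ is the complex vector space with basis $\xi_{\mathfrak a}$ indexed by the half-diagrams, and $U(n;p)$ is the subspace spanned by the $\xi_{\mathfrak a}$ for which $\mathfrak a$ has exactly $p$ pairs, so that $U(n)=\bigoplus_{p=0}^{\lfloor n/2\rfloor}U(n;p)$. $TL_n$ acts on $U(n)$ bilinearly as follows: identify the $i$th point of $\mathfrak a$ with the $(2n-i+1)$th point of $\mathfrak p$ for $1\le i\le n$. If an edge path joins two different through-strings of $\mathfrak a$,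 then $e_{\mathfrak p}\xi_{\mathfrak a}=0$. Otherwise $e_{\mathfrak p}\xi_{\mathfrak a}=q^{c}\xi_{\mathfrak b}$, where $c$ is the number of closed loops and $\mathfrak b$ is the half-diagram left on the points $1,\dots,n$ of $\mathfrak p$ after the loops and the identified points are deleted. The *diagrammatic form* $\langle\cdot,\cdot\rangle$ on $U(n)$ is the sesquilinear form (linear in the first variable, conjugate-linear in the second) determined as follows: identify the $i$th points of $\mathfrak a$ and $\mathfrak b$ for all $i$. Then $\langle\xi_{\mathfrak a},\xi_{\mathfrak b}\rangle=0$ if an edge path joins two different through-strings of $\mathfrak a$ or two different through-strings of $\mathfrak b$, and $\langle\xi_{\mathfrak a},\xi_{\mathfrak b}\rangle=q^{c}$ otherwise, where $c$ is the number of closed loops. A sesquilinear form $B$ on $U(n)$ is said to *have $*$ as adjoint* if $B(e\xi,\eta)=B(\xi,e^*\eta)$ for all $e\in TL_n$ and $\xi,\eta\in U(n)$. *Claim.* The diagrammatic form has $*$ as adjoint, and it is the only sesquilinear form with this property up to scalar multiples, one scalar for each number of pairs. That is, a sesquilinear form $B$ on $U(n)$ has $*$ as adjoint if and only if 1. $B(\xi,\eta)=0$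 whenever $\xi\in U(n;p)$, $\eta\in U(n;p')$ and $p\ne p'$; and 2. for every $p$ there is a scalar $c_p\in\mathbb C$ such that $B(\xi,\eta)=c_p\langle\xi,\eta\rangle$ for all $\xi,\eta\in U(n;p)$. -/

import Mathlib

open scoped ComplexConjugate

noncomputable section

namespace TemperleyLieb

/-- A noncrossing pairing of the `2 * n` points `0, 1, …, 2 * n - 1` (a "diagram"): each point is
sent to its partner, which is another point, and no two arches cross. In strand pictures the
points `0, …, n - 1` run from top to bottom along the left side of a rectangle and the points
`n, …, 2 * n - 1` from bottom to top along the right side. -/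
@[ext]
structure Diagram (n : ℕ) where
  partner : Fin (2 * n) → Fin (2 * n)
  partner_partner : ∀ i, partner (partner i) = i
  partner_ne : ∀ i, partner i ≠ i
  noncrossing : ∀ i k j l, i < k → k < j → j < l → partner i = j → partner k ≠ l

/-- A noncrossing half-diagram on the `n` points `0, …, n - 1`: each point is sent to its partner,
where a point that is its own partner carries a through-string. No two arches cross, and there is
no through-string under an arch. -/
@[ext]
structure HalfDiagram (n : ℕ) where
  partner : Fin n → Fin n
  partner_partner : ∀ i, partner (partner i) = i
  noncrossing : ∀ i k j l, i < k → k < j → j < l → partner i = j → partner k ≠ l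
  through_outside : ∀ i k j, i < k → k < j → partner i = j → partner k ≠ k

instance (n : ℕ) : Finite (HalfDiagram n) :=
  Finite.of_injective HalfDiagram.partner fun _ _ h => HalfDiagram.ext h

instance (n : ℕ) : Fintype (HalfDiagram n) := Fintype.ofFinite _

/-- The point `i` of a half-diagram carries a through-string. -/
def HalfDiagram.IsThrough {n : ℕ} (a : HalfDiagram n) (i : Fin n) : Prop := a.partner i = i

/-- The number of arches of a half-diagram. -/
def HalfDiagram.numPairs {n : ℕ} (a : HalfDiagram n) : ℕ :=
  (Finset.univ.filter fun i => i < a.partner i).card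

/-- The transpose of a diagram (left-right flip of the strand picture): the `i`th point is
relabelled as the `i`th point from the end. -/
def Diagram.transpose {n : ℕ} (d : Diagram n) : Diagram n where
  partner i := (d.partner i.rev).rev
  partner_partner i := by simp [d.partner_partner]
  partner_ne i h := d.partner_ne i.rev (by rw [← Fin.rev_inj, Fin.rev_rev]; exact h)
  noncrossing i k j l hik hkj hjl hi hk := by
    have hi' : d.partner j.rev = i.rev := by
      rw [← hi, Fin.rev_rev, d.partner_partner]
    have hk' : d.partner l.rev = k.rev := by
      rw [← hk, Fin.rev_rev, d.partner_partner]
    exact d.noncrossing l.rev j.rev k.rev i.rev (Fin.rev_lt_rev.2 hjl) (Fin.rev_lt_rev.2 hkj)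
      (Fin.rev_lt_rev.2 hik) hk' hi'

/-- The underlying vector space of the Temperley-Lieb algebra `TL_n`: formal complex linear
combinations of diagrams. -/
abbrev TL (n : ℕ) : Type := Diagram n →₀ ℂ

/-- The space `U(n)` of formal complex linear combinations of half-diagrams. -/
abbrev U (n : ℕ) : Type := HalfDiagram n →₀ ℂ

/-- The basis vector `ξ_a` of `U(n)`. -/
abbrev xi {n : ℕ} (a : HalfDiagram n) : U n := Finsupp.single a 1

/-- The subspace `U(n; p)` generated by the half-diagrams with exactly `p` arches. -/
def UPairs (n p : ℕ) : Submodule ℂ (U n) :=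
  Submodule.span ℂ {x | ∃ a : HalfDiagram n, a.numPairs = p ∧ x = xi a}

/-- The involution `*` on `TL_n`: the conjugate-linear extension of the transpose. -/
def tlStar {n : ℕ} (e : TL n) : TL n :=
  e.sum fun d s => Finsupp.single d.transpose (conj s)

/-! ### The action of `TL_n` on `U(n)` -/

/-- The `i`th point on the left side of a diagram. -/
def leftPt {n : ℕ} (i : Fin n) : Fin (2 * n) := Fin.castLE (by omega) i

/-- The point on the right side of a diagram at the same height as the `i`th point on the left. -/
def rightPt {n : ℕ} (i : Fin n) : Fin (2 * n) := (leftPt i).rev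

/-- The concatenation of a diagram `d` with a half-diagram `a`, the `i`th point of `a` being
identified with the right point of `d` at height `i`. Parallel edges are merged and the
through-strings of `a` are not drawn; neither affects which points are joined by an edge path. -/
def concat {n : ℕ} (d : Diagram n) (a : HalfDiagram n) : SimpleGraph (Fin (2 * n)) :=
  SimpleGraph.fromRel fun x y =>
    d.partner x = y ∨ ∃ i, x = rightPt i ∧ y = rightPt (a.partner i)

/-- In the concatenation some edge path joins two different through-strings of `a`. -/
def JoinsThrough {n : ℕ} (d : Diagram n) (a : HalfDiagram n) : Prop :=
  ∃ i j, i ≠ j ∧ a.IsThrough i ∧ a.IsThrough j ∧ (concat d a).Reachable (rightPt i) (rightPt j)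

/-- The number of closed loops in the concatenation: the connected components that contain
neither a point on the left side of `d` nor a through-string of `a`. -/
def concatLoops {n : ℕ} (d : Diagram n) (a : HalfDiagram n) : ℕ :=
  Nat.card {C : (concat d a).ConnectedComponent //
    ∀ i : Fin n, leftPt i ∉ C.supp ∧ (a.IsThrough i → rightPt i ∉ C.supp)}

/-- `b` is the half-diagram on the left points that the concatenation leaves behind when loops
and identified points are deleted: two different points are paired in `b` exactly when an edge path
joins them; the other points carry through-strings. There is at most one such `b`. -/
def IsProduct {n : ℕ} (d : Diagram n) (a b : HalfDiagram n) : Prop :=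
  ∀ i j, i ≠ j → (b.partner i = j ↔ (concat d a).Reachable (leftPt i) (leftPt j))

open Classical in
/-- The product `e_d ξ_a`: it is `0` if two through-strings of `a` get joined, and otherwise
`q ^ c • ξ_b`, where `c` is the number of closed loops and `b` is the resulting half-diagram. -/
def actBasis {n : ℕ} (q : ℝ) (d : Diagram n) (a : HalfDiagram n) : U n :=
  if JoinsThrough d a then 0
  else ∑ b : HalfDiagram n, if IsProduct d a b then (q : ℂ) ^ concatLoops d a • xi b else 0

/-- The action of `TL_n` on `U(n)` with loop parameter `q`, the bilinear extension
of `actBasis`. -/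
def act (n : ℕ) (q : ℝ) : TL n →ₗ[ℂ] U n →ₗ[ℂ] U n :=
  Finsupp.linearCombination ℂ fun d => Finsupp.linearCombination ℂ fun a => actBasis q d a

/-! ### The diagrammatic sesquilinear form on `U(n)` -/

/-- The two half-diagrams `a` and `b` glued along their points. -/
def glue {n : ℕ} (a b : HalfDiagram n) : SimpleGraph (Fin n) :=
  SimpleGraph.fromRel fun x y => a.partner x = y ∨ b.partner x = y

/-- In the gluing some edge path joins two different through-strings on the same side. -/
def GlueJoinsThrough {n : ℕ} (a b : HalfDiagram n) : Prop :=
  ∃ i j, i ≠ j ∧ (glue a b).Reachable i j ∧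
    ((a.IsThrough i ∧ a.IsThrough j) ∨ (b.IsThrough i ∧ b.IsThrough j))

/-- The number of closed loops in the gluing: the connected components without through-strings. -/
def glueLoops {n : ℕ} (a b : HalfDiagram n) : ℕ :=
  Nat.card {C : (glue a b).ConnectedComponent //
    ∀ i ∈ C.supp, ¬ a.IsThrough i ∧ ¬ b.IsThrough i}

open Classical in
/-- The value `⟨ξ_a, ξ_b⟩`. -/
def formBasis {n : ℕ} (q : ℝ) (a b : HalfDiagram n) : ℂ :=
  if GlueJoinsThrough a b then 0 else (q : ℂ) ^ glueLoops a b

/-- Sesquilinear forms on `U(n)`, linear in the first and conjugate-linear in the second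
variable. -/
abbrev SesqForm (n : ℕ) : Type := U n →ₗ[ℂ] U n →ₗ⋆[ℂ] ℂ

/-- The diagrammatic form `⟨·, ·⟩` on `U(n)`, the sesquilinear extension of `formBasis`. -/
def diagramForm (n : ℕ) (q : ℝ) : SesqForm n :=
  LinearMap.mk₂'ₛₗ (RingHom.id ℂ) (starRingEnd ℂ)
    (fun x y => ∑ a : HalfDiagram n, ∑ b : HalfDiagram n, x a * conj (y b) * formBasis q a b)
    (by intro x x' y; simp [add_mul, Finset.sum_add_distrib])
    (by intro c x y; simp [Finset.mul_sum, mul_assoc])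
    (by intro x y y'; simp [mul_add, add_mul, Finset.sum_add_distrib])
    (by
      intro c x y
      simp only [Finsupp.smul_apply, smul_eq_mul, map_mul, Finset.mul_sum]
      refine Finset.sum_congr rfl fun a _ => Finset.sum_congr rfl fun b _ => ?_
      ring)

/-- The involution `*` of `TL_n` acts as the adjoint with respect to the form `B`. -/
def IsStarAdjoint {n : ℕ} (q : ℝ) (B : SesqForm n) : Prop :=
  ∀ (e : TL n) (x y : U n), B (act n q e x) y = B x (act n q (tlStar e) y)

end TemperleyLieb

end

/-! The form has `*` as adjoint because both sides of the identity evaluate one picture. Close a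
diagram `d` on the right by `a` and on the left by `b`: the value `closureValue` (zero if two
through-strings on one side meet, otherwise a power of `q`) is what pairing `e_d ξ_a` with `ξ_b`
gives (`diagramForm_actBasis`), and flipping the picture leaves it unchanged
(`closureValue_transpose`). Since these values are real and the form is conjugate-symmetric,
adjointness follows.

Uniqueness comes from rank one operators. If `a` and `b` have equally many through-strings, joining
these in order gives the diagram `bridge φ`, with `a` on the left and `b` on the right. It sends
`ξ_c` to `⟨ξ_c, ξ_b⟩ ξ_a` whenever `c` has at most as many pairs as `b` (`actBasis_bridge`), and its
transpose is the bridge in the other direction. For `a = b` the adjoint property gives `⟨ξ_a, ξ_a⟩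
B(ξ_a, ξ_c) = ⟨ξ_c, ξ_a⟩ B(ξ_a, ξ_a)`, and likewise with the arguments of `B` swapped on the left.
The factor `⟨ξ_a, ξ_a⟩` is a power of `q`, hence nonzero, so `B` inherits orthogonality of different
pair numbers. A bridge between different half-diagrams shows that `B(ξ_a, ξ_a) / ⟨ξ_a, ξ_a⟩` depends
only on the number of pairs. Conversely the action preserves each `U(n; p)`, so rescaling the form
there keeps the adjoint property.

The combinatorics rests on graphs made from two involutions: a component containing a fixed point is
a path with two ends (`component_ends`). That the product is again noncrossing is a discrete Jordan
curve argument, by parity (`parityBelow_concat`). -/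

noncomputable section

namespace TemperleyLieb

/-! ### Components of the graph of two involutions -/

section TwoInvolutions

variable {V : Type*}

/-- The graph whose edges are the orbits of two maps (usually involutions). -/
def twoInv (σ τ : V → V) : SimpleGraph V :=
  SimpleGraph.fromRel fun x y => σ x = y ∨ τ x = y

theorem twoInv_comm (σ τ : V → V) : twoInv σ τ = twoInv τ σ := by
  simp only [twoInv, or_comm]

theorem reachable_left (σ τ : V → V) (x : V) : (twoInv σ τ).Reachable x (σ x) := by
  by_cases h : x = σ x
  · rw [← h]
  · exact SimpleGraph.Adj.reachable (by simp [twoInv, h])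

theorem reachable_right (σ τ : V → V) (x : V) : (twoInv σ τ).Reachable x (τ x) := by
  rw [twoInv_comm]; exact reachable_left τ σ x

/-- Involutions are their own inverses, so traversing an edge in either direction applies `σ` or
`τ`. This is the induction principle behind the later reachability arguments. -/
theorem reachable_closed {σ τ : V → V} (hσ : Function.Involutive σ) (hτ : Function.Involutive τ)
    {P : V → Prop} (h1 : ∀ x, P x → P (σ x)) (h2 : ∀ x, P x → P (τ x)) {x y : V}
    (h : (twoInv σ τ).Reachable x y) (hx : P x) : P y := by
  obtain ⟨w⟩ := h
  induction w with
  | nil => exact hx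
  | cons hadj _ ih =>
    refine ih ?_
    simp only [twoInv, SimpleGraph.fromRel_adj] at hadj
    rcases hadj.2 with (h | h) | (h | h)
    · exact h ▸ h1 _ hx
    · exact h ▸ h2 _ hx
    · simpa only [← h, hσ _] using h1 _ hx
    · simpa only [← h, hτ _] using h2 _ hx

/-- A component that contains a fixed point of `τ` is a path: it contains exactly one further
fixed point of `σ` or of `τ`. -/
theorem component_ends [Finite V] {σ τ : V → V} (hσ : Function.Involutive σ)
    (hτ : Function.Involutive τ) {x : V} (hx : τ x = x) :
    (∃ y, y ≠ x ∧ τ y = y ∧ (twoInv σ τ).Reachable x y ∧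
      (∀ z, (twoInv σ τ).Reachable x z → τ z = z → z = x ∨ z = y) ∧
      ∀ z, (twoInv σ τ).Reachable x z → σ z ≠ z) ∨
    ((∀ z, (twoInv σ τ).Reachable x z → τ z = z → z = x) ∧
      ∃ y, σ y = y ∧ (twoInv σ τ).Reachable x y ∧
        ∀ z, (twoInv σ τ).Reachable x z → σ z = z → z = y) := by
  set s : Equiv.Perm V := hσ.toPerm with hs
  set t : Equiv.Perm V := hτ.toPerm with ht
  have hss : s * s = 1 := by ext z; exact hσ z
  have htt : t * t = 1 := by ext z; exact hτ z
  -- The permutations `s` and `t` generate a dihedral group with rotation `p`. As `t` fixes `x`, the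
  -- component of `x` is the cycle of `p` through `x`, on which `τ` and `σ` act by the reflections
  -- `k ↦ -k` and `k ↦ -k - 1` of the exponent.
  set p : Equiv.Perm V := t * s with hp
  have hpinv : p⁻¹ = s * t := by
    rw [inv_eq_iff_mul_eq_one, hp, mul_assoc, ← mul_assoc s, hss, one_mul, htt]
  have htinv : t⁻¹ = t := inv_eq_of_mul_eq_one_left htt
  have htp (k : ℤ) : t * p ^ k = p ^ (-k) * t := by
    have h : t * p * t⁻¹ = p⁻¹ := by rw [hpinv, htinv, hp, ← mul_assoc, htt, one_mul]
    rw [zpow_neg, ← inv_zpow, ← h, conj_zpow]; group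
  have htx : t x = x := hx
  have hτk (k : ℤ) : τ ((p ^ k) x) = (p ^ (-k)) x := by
    have := Equiv.congr_fun (htp k) x
    rwa [Equiv.Perm.mul_apply, Equiv.Perm.mul_apply, htx] at this
  have hσk (k : ℤ) : σ ((p ^ k) x) = (p ^ (-k - 1)) x := by
    have h1 : s = p⁻¹ * t := by rw [hpinv, mul_assoc, htt, mul_one]
    have h2 : s * p ^ k = p ^ (-k - 1) * t := by
      rw [h1, mul_assoc, htp, ← mul_assoc, ← zpow_neg_one, ← zpow_add]; congr 2; ring
    have := Equiv.congr_fun h2 x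
    rwa [Equiv.Perm.mul_apply, Equiv.Perm.mul_apply, htx] at this
  have hreach (k : ℤ) : (twoInv σ τ).Reachable x ((p ^ k) x) := by
    have hpos (k : ℕ) : (twoInv σ τ).Reachable x ((p ^ (k : ℤ)) x) := by
      induction k with
      | zero => simp
      | succ k ih =>
        refine ih.trans ((reachable_left σ τ _).trans ?_)
        convert reachable_right σ τ _ using 1
        rw [Nat.cast_succ, add_comm, zpow_add, zpow_one]; rfl
    rcases Int.eq_nat_or_neg k with ⟨m, rfl | rfl⟩
    · exact hpos m
    · rw [← hτk]; exact (hpos m).trans (reachable_right σ τ _)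
  have hcomp {z : V} (hz : (twoInv σ τ).Reachable x z) : ∃ k : ℤ, z = (p ^ k) x := by
    refine reachable_closed hσ hτ (P := fun z => ∃ k : ℤ, z = (p ^ k) x) ?_ ?_ hz ⟨0, by simp⟩
    · rintro _ ⟨k, rfl⟩; exact ⟨_, hσk k⟩
    · rintro _ ⟨k, rfl⟩; exact ⟨_, hτk k⟩
  -- On a cycle of length `m` the fixed exponents solve `2k ≡ 0` for `τ` and `2k + 1 ≡ 0` for `σ`.
  -- For `m = 2l` these are `0, l` and none; for `m = 2l + 1` they are `0` and `l`.
  set m := MulAction.period p x with hm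
  have hm0 : 0 < m := by
    have : IsOfFinOrder p := isOfFinOrder_of_finite p
    exact MulAction.period_pos_of_orderOf_pos this.orderOf_pos x
  have heq (j k : ℤ) : (p ^ j) x = (p ^ k) x ↔ (m : ℤ) ∣ j - k := by
    rw [hm, ← MulAction.zpow_smul_eq_iff_period_dvd, sub_eq_neg_add, zpow_add, zpow_neg,
      mul_smul, inv_smul_eq_iff]; rfl
  have heq0 (j : ℤ) : (p ^ j) x = x ↔ (m : ℤ) ∣ j := by simpa using heq j 0
  have hτfix (k : ℤ) : τ ((p ^ k) x) = (p ^ k) x ↔ (m : ℤ) ∣ 2 * k := by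
    rw [hτk, eq_comm, heq]; ring_nf
  have hσfix (k : ℤ) : σ ((p ^ k) x) = (p ^ k) x ↔ (m : ℤ) ∣ 2 * k + 1 := by
    rw [hσk, eq_comm, heq]; ring_nf
  rcases Nat.even_or_odd' m with ⟨l, hl | hl⟩
  · refine Or.inl ⟨(p ^ (l : ℤ)) x, ?_, ?_, hreach _, ?_, ?_⟩
    · rw [Ne, heq0]; intro h
      have := Nat.le_of_dvd (by omega) (Int.natCast_dvd_natCast.1 h)
      omega
    · rw [hτfix]; exact ⟨1, by omega⟩
    · intro z hz hfix
      obtain ⟨k, rfl⟩ := hcomp hz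
      rw [hτfix] at hfix
      obtain ⟨c, hc⟩ := hfix
      have hk : k = l * c := by
        have : (m : ℤ) = 2 * l := by exact_mod_cast hl
        rw [this] at hc; linarith
      rw [heq0, heq]
      have hml : (m : ℤ) = 2 * l := by exact_mod_cast hl
      rcases Int.even_or_odd' c with ⟨e, he | he⟩
      · left; exact ⟨e, by rw [hk, he, hml]; ring⟩
      · right; exact ⟨e, by rw [hk, he, hml]; ring⟩
    · intro z hz hfix
      obtain ⟨k, rfl⟩ := hcomp hz
      rw [hσfix] at hfix
      obtain ⟨c, hc⟩ := hfix
      have hml : (m : ℤ) = 2 * l := by exact_mod_cast hl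
      rw [hml, mul_assoc] at hc
      omega
  · have hml : (m : ℤ) = 2 * l + 1 := by exact_mod_cast hl
    have hcop : IsCoprime (m : ℤ) 2 := ⟨1, -l, by rw [hml]; ring⟩
    refine Or.inr ⟨?_, (p ^ (l : ℤ)) x, ?_, hreach _, ?_⟩
    · intro z hz hfix
      obtain ⟨k, rfl⟩ := hcomp hz
      rw [hτfix] at hfix
      rw [heq0]
      exact hcop.dvd_of_dvd_mul_left hfix
    · rw [hσfix, hml]
    · intro z hz hfix
      obtain ⟨k, rfl⟩ := hcomp hz
      rw [hσfix] at hfix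
      rw [heq]
      refine hcop.dvd_of_dvd_mul_left ?_
      have := dvd_sub hfix (dvd_refl (m : ℤ))
      convert this using 1; rw [hml]; ring

/-- If `σ` has no fixed points, every fixed point of `τ` is joined to exactly one other one. -/
theorem exists_other_end [Finite V] {σ τ : V → V} (hσ : Function.Involutive σ)
    (hτ : Function.Involutive τ) (hfree : ∀ x, σ x ≠ x) {x : V} (hx : τ x = x) :
    ∃ y, y ≠ x ∧ τ y = y ∧ (twoInv σ τ).Reachable x y ∧
      ∀ z, (twoInv σ τ).Reachable x z → τ z = z → z = x ∨ z = y := by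
  rcases component_ends hσ hτ hx with ⟨y, h1, h2, h3, h4, -⟩ | ⟨-, y, h, -⟩
  · exact ⟨y, h1, h2, h3, h4⟩
  · exact absurd h (hfree y)

/-- If `σ` has no fixed points, no component contains three fixed points of `τ`. -/
theorem eq_of_three_ends [Finite V] {σ τ : V → V} (hσ : Function.Involutive σ)
    (hτ : Function.Involutive τ) (hfree : ∀ x, σ x ≠ x) {x y z : V} (hx : τ x = x) (hy : τ y = y)
    (hz : τ z = z) (hxy : (twoInv σ τ).Reachable x y) (hxz : (twoInv σ τ).Reachable x z)
    (hyx : y ≠ x) (hzx : z ≠ x) : z = y := by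
  obtain ⟨w, -, -, -, h⟩ := exists_other_end hσ hτ hfree hx
  rw [(h y hxy hy).resolve_left hyx, (h z hxz hz).resolve_left hzx]

/-- If there are at least as many fixed points of `τ` as of `σ` and no two fixed points of `τ` are
joined, then each is joined to a fixed point of `σ`, which exhausts these, and no two of them are
joined. -/
theorem separated_of_card_le [Finite V] {σ τ : V → V} (hσ : Function.Involutive σ)
    (hτ : Function.Involutive τ)
    (hsep : ∀ x y, τ x = x → τ y = y → (twoInv σ τ).Reachable x y → x = y) :
    Nat.card {x // τ x = x} ≤ Nat.card {x // σ x = x} ∧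
    (∀ x, τ x = x → ∃ y, σ y = y ∧ (twoInv σ τ).Reachable x y) ∧
    (Nat.card {x // σ x = x} ≤ Nat.card {x // τ x = x} →
      ∀ x y, σ x = x → σ y = y → (twoInv σ τ).Reachable x y → x = y) := by
  have key (x : {x // τ x = x}) : ∃ y : {y // σ y = y}, (twoInv σ τ).Reachable x.1 y.1 ∧
      ∀ z, (twoInv σ τ).Reachable x.1 z → σ z = z → z = y.1 := by
    rcases component_ends hσ hτ x.2 with ⟨y, h1, h2, h3, -⟩ | ⟨-, y, h1, h2, h3⟩
    · exact absurd (hsep _ _ x.2 h2 h3) h1.symm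
    · exact ⟨⟨y, h1⟩, h2, h3⟩
  choose f hf hf' using key
  have hinj : Function.Injective f := fun x x' h =>
    Subtype.ext (hsep _ _ x.2 x'.2 ((hf x).trans (h ▸ (hf x').symm)))
  refine ⟨Nat.card_le_card_of_injective f hinj, fun x hx => ⟨_, (f ⟨x, hx⟩).2, hf ⟨x, hx⟩⟩, ?_⟩
  intro hle x y hx hy hxy
  -- With equal counts the injection `f` is onto, so each fixed point of `σ` is the unique one in
  -- the component of some fixed point of `τ`.
  have hsurj : Function.Surjective f :=
    ((Nat.bijective_iff_injective_and_card f).2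
      ⟨hinj, le_antisymm (Nat.card_le_card_of_injective f hinj) hle⟩).2
  obtain ⟨u, hu⟩ := hsurj ⟨x, hx⟩
  have hux : (f u).1 = x := by rw [hu]
  have := hf' u y ((hf u).trans (hux ▸ hxy)) hy
  rw [this, hux]

end TwoInvolutions

/-- A correspondence of connected components that is induced by a map of vertices. -/
theorem card_components_eq {V W : Type*} {G : SimpleGraph V} {H : SimpleGraph W}
    {S : G.ConnectedComponent → Prop} {S' : H.ConnectedComponent → Prop} (f : V → W)
    (h1 : ∀ x y, S (G.connectedComponentMk x) → S (G.connectedComponentMk y) →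
      (G.Reachable x y ↔ H.Reachable (f x) (f y)))
    (h2 : ∀ x, S (G.connectedComponentMk x) → S' (H.connectedComponentMk (f x)))
    (h3 : ∀ w, S' (H.connectedComponentMk w) →
      ∃ x, S (G.connectedComponentMk x) ∧ H.Reachable (f x) w) :
    Nat.card {C // S C} = Nat.card {C // S' C} := by
  have hout (C : G.ConnectedComponent) : G.connectedComponentMk C.out = C := Quot.out_eq C
  refine Nat.card_eq_of_bijective
    (fun C => ⟨H.connectedComponentMk (f C.1.out), h2 _ (by rw [hout]; exact C.2)⟩) ⟨?_, ?_⟩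
  · intro C D h
    have h' : H.Reachable (f C.1.out) (f D.1.out) :=
      SimpleGraph.ConnectedComponent.eq.1 (Subtype.ext_iff.1 h)
    rw [← h1 _ _ (by rw [hout]; exact C.2) (by rw [hout]; exact D.2)] at h'
    ext1
    rw [← hout C.1, ← hout D.1]
    exact SimpleGraph.ConnectedComponent.eq.2 h'
  · rintro ⟨D, hD⟩
    induction D using SimpleGraph.ConnectedComponent.ind with
    | h w =>
      obtain ⟨x, hx, hxw⟩ := h3 w hD
      refine ⟨⟨G.connectedComponentMk x, hx⟩, ?_⟩
      ext1
      refine SimpleGraph.ConnectedComponent.eq.2 (SimpleGraph.Reachable.trans ?_ hxw)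
      refine (h1 _ _ (by rw [hout]; exact hx) hx).1 ?_
      exact SimpleGraph.ConnectedComponent.eq.1 (hout _)

/-! ### Left and right points, and nesting of arches -/

variable {n : ℕ}

@[simp] theorem leftPt_val (i : Fin n) : (leftPt i : ℕ) = i := rfl

@[simp] theorem rightPt_val (i : Fin n) : (rightPt i : ℕ) = 2 * n - (i + 1) := by
  simp [rightPt, Fin.val_rev]

theorem leftPt_inj {i j : Fin n} : leftPt i = leftPt j ↔ i = j := by
  simp [Fin.ext_iff]

theorem rightPt_inj {i j : Fin n} : rightPt i = rightPt j ↔ i = j := by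
  simp [rightPt, leftPt_inj]

theorem leftPt_lt_rightPt (i j : Fin n) : leftPt i < rightPt j := by
  rw [Fin.lt_def, leftPt_val, rightPt_val]; omega

theorem leftPt_ne_rightPt (i j : Fin n) : leftPt i ≠ rightPt j := (leftPt_lt_rightPt i j).ne

theorem leftPt_lt_leftPt {i j : Fin n} : leftPt i < leftPt j ↔ i < j := Iff.rfl

theorem rightPt_lt_rightPt {i j : Fin n} : rightPt i < rightPt j ↔ j < i := by
  rw [rightPt, rightPt, Fin.rev_lt_rev, leftPt_lt_leftPt]

theorem rev_leftPt (i : Fin n) : (leftPt i).rev = rightPt i := rfl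

theorem rev_rightPt (i : Fin n) : (rightPt i).rev = leftPt i := Fin.rev_rev _

theorem leftPt_or_rightPt (x : Fin (2 * n)) : (∃ i, x = leftPt i) ∨ ∃ i, x = rightPt i := by
  by_cases h : (x : ℕ) < n
  · exact Or.inl ⟨⟨x, h⟩, rfl⟩
  · refine Or.inr ⟨⟨2 * n - (x + 1), by omega⟩, ?_⟩
    rw [Fin.ext_iff, rightPt_val]; simp only; omega

/-- The function on `2 * n` points given by `f` on the left points and by `g` on the right
points. -/
def sideCases {α : Sort*} (f g : Fin n → α) (x : Fin (2 * n)) : α :=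
  if h : (x : ℕ) < n then f ⟨x, h⟩ else g ⟨2 * n - (x + 1), by omega⟩

@[simp] theorem sideCases_leftPt {α : Sort*} (f g : Fin n → α) (i : Fin n) :
    sideCases f g (leftPt i) = f i := by
  simp [sideCases]

@[simp] theorem sideCases_rightPt {α : Sort*} (f g : Fin n → α) (i : Fin n) :
    sideCases f g (rightPt i) = g i := by
  have h : ¬ ((rightPt i : ℕ) < n) := by rw [rightPt_val]; omega
  rw [sideCases, dif_neg h]
  congr 1
  simp only [Fin.ext_iff, rightPt_val]; omega

/-- The map on `2 * n` points that acts as `f` on the left points and as `g` on the right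
points. -/
def capInv (f g : Fin n → Fin n) : Fin (2 * n) → Fin (2 * n) :=
  sideCases (fun i => leftPt (f i)) (fun i => rightPt (g i))

@[simp] theorem capInv_leftPt (f g : Fin n → Fin n) (i : Fin n) :
    capInv f g (leftPt i) = leftPt (f i) :=
  sideCases_leftPt _ _ i

@[simp] theorem capInv_rightPt (f g : Fin n → Fin n) (i : Fin n) :
    capInv f g (rightPt i) = rightPt (g i) :=
  sideCases_rightPt _ _ i

theorem capInv_involutive {f g : Fin n → Fin n} (hf : Function.Involutive f)
    (hg : Function.Involutive g) : Function.Involutive (capInv f g) := by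
  intro x
  rcases leftPt_or_rightPt x with ⟨i, rfl⟩ | ⟨i, rfl⟩
  · simp [hf i]
  · simp [hg i]

/-- Leaving the left points fixed makes all open ends of the concatenation, left points and
through-strings of `a`, the fixed points of one involution; the other, `d.partner`, has none. -/
theorem concat_eq (d : Diagram n) (a : HalfDiagram n) :
    concat d a = twoInv d.partner (capInv id a.partner) := by
  have key (x y : Fin (2 * n)) (hxy : x ≠ y) :
      (∃ i, x = rightPt i ∧ y = rightPt (a.partner i)) ↔ capInv id a.partner x = y := by
    rcases leftPt_or_rightPt x with ⟨i, rfl⟩ | ⟨i, rfl⟩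
    · simp [hxy, leftPt_ne_rightPt]
    · simp [rightPt_inj, eq_comm]
  ext x y
  simp only [concat, twoInv, SimpleGraph.fromRel_adj, ne_eq, and_congr_right_iff]
  intro hxy
  rw [key x y hxy, key y x (Ne.symm hxy)]

theorem HalfDiagram.involutive (a : HalfDiagram n) : Function.Involutive a.partner :=
  a.partner_partner

theorem Diagram.involutive (d : Diagram n) : Function.Involutive d.partner :=
  d.partner_partner

/-- A partner outside the arch would cross it, and the endpoints are already each other's partners.
-/
theorem HalfDiagram.nested (a : HalfDiagram n) {i k j : Fin n} (hik : i < k) (hkj : k < j)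
    (hij : a.partner i = j) : i < a.partner k ∧ a.partner k < j := by
  have hji : a.partner j = i := by rw [← hij, a.partner_partner]
  constructor
  · by_contra! h
    rcases h.lt_or_eq with h | h
    · exact a.noncrossing _ _ _ _ h hik hkj (a.partner_partner k) hij
    · rw [← h, a.partner_partner] at hij; exact hkj.ne hij
  · by_contra! h
    rcases h.lt_or_eq with h | h
    · exact a.noncrossing _ _ _ _ hik hkj h hij rfl
    · rw [h, a.partner_partner] at hji; exact hik.ne hji.symm

theorem Diagram.nested (a : Diagram n) {i k j : Fin (2 * n)} (hik : i < k) (hkj : k < j)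
    (hij : a.partner i = j) : i < a.partner k ∧ a.partner k < j := by
  have hji : a.partner j = i := by rw [← hij, a.partner_partner]
  constructor
  · by_contra! h
    rcases h.lt_or_eq with h | h
    · exact a.noncrossing _ _ _ _ h hik hkj (a.partner_partner k) hij
    · rw [← h, a.partner_partner] at hij; exact hkj.ne hij
  · by_contra! h
    rcases h.lt_or_eq with h | h
    · exact a.noncrossing _ _ _ _ hik hkj h hij rfl
    · rw [h, a.partner_partner] at hji; exact hik.ne hji.symm

/-! ### Parity argument: the product is noncrossing -/

/-- The parity of the number of points of `P` below `x`. -/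
def parityBelow {m : ℕ} (P : Fin m → Prop) [DecidablePred P] (x : Fin m) : ZMod 2 :=
  ∑ z, if P z ∧ z < x then 1 else 0

theorem sum_pred_eq_zero {m : ℕ} (P : Fin m → Prop) [DecidablePred P] (ρ : Fin m → Fin m)
    (hρ : ∀ z, P z → P (ρ z) ∧ ρ (ρ z) = z ∧ ρ z ≠ z) :
    (∑ z, if P z then 1 else 0 : ZMod 2) = 0 := by
  rw [← Finset.sum_filter]
  refine Finset.sum_involution (fun z _ => ρ z) ?_ ?_ ?_ ?_
  · intros; decide
  · intro z hz _; exact (hρ z (by simpa using hz)).2.2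
  · intro z hz; simpa using (hρ z (by simpa using hz)).1
  · intro z hz; exact (hρ z (by simpa using hz)).2.1

/-- The points of `P` strictly between `x` and `y` are paired off by `ρ`, so their number is even.
-/
theorem parityBelow_eq_of_lt {m : ℕ} {P : Fin m → Prop} [DecidablePred P] (ρ : Fin m → Fin m)
    {x y : Fin m} (hxy : x < y) (hx : ¬ P x)
    (hρ : ∀ z, P z → P (ρ z) ∧ ρ (ρ z) = z ∧ ρ z ≠ z)
    (hnest : ∀ z, P z → x < z → z < y → x < ρ z ∧ ρ z < y) :
    parityBelow P x = parityBelow P y := by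
  have h := sum_pred_eq_zero (fun z => P z ∧ x < z ∧ z < y) ρ
    (fun z hz => ⟨⟨(hρ z hz.1).1, hnest z hz.1 hz.2.1 hz.2.2⟩, (hρ z hz.1).2⟩)
  have h2 : parityBelow P y =
      parityBelow P x + ∑ z, if P z ∧ x < z ∧ z < y then 1 else 0 := by
    rw [parityBelow, parityBelow, ← Finset.sum_add_distrib]
    refine Finset.sum_congr rfl fun z _ => ?_
    by_cases hz : P z
    · have hzx : z ≠ x := fun e => hx (e ▸ hz)
      rcases lt_or_gt_of_ne hzx with h | h
      · simp [hz, h, h.trans hxy, h.not_gt]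
      · simp [hz, h, h.not_gt]
    · simp [hz]
  rw [h2, h, add_zero]

theorem IsProduct.unique {d : Diagram n} {a b b' : HalfDiagram n} (h : IsProduct d a b)
    (h' : IsProduct d a b') : b = b' := by
  ext1
  funext i
  by_cases hi : b.partner i = i
  · by_contra hne
    have hne' : i ≠ b'.partner i := fun e => hne (hi.trans e)
    exact hne ((h i _ hne').2 ((h' i _ hne').1 rfl))
  · exact ((h' i _ (Ne.symm hi)).2 ((h i _ (Ne.symm hi)).1 rfl)).symm

section Concat

variable (d : Diagram n) (a : HalfDiagram n)

theorem capInv_id_involutive : Function.Involutive (capInv id a.partner) :=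
  capInv_involutive (fun _ => rfl) a.involutive

theorem capInv_id_rightPt_eq {a : HalfDiagram n} {i : Fin n} :
    capInv id a.partner (rightPt i) = rightPt i ↔ a.IsThrough i := by
  rw [capInv_rightPt, rightPt_inj]; rfl

theorem concat_other_end {x : Fin (2 * n)} (hx : capInv id a.partner x = x) :
    ∃ y, y ≠ x ∧ capInv id a.partner y = y ∧ (concat d a).Reachable x y ∧
      ∀ z, (concat d a).Reachable x z → capInv id a.partner z = z → z = x ∨ z = y := by
  rw [concat_eq]
  exact exists_other_end d.involutive (capInv_id_involutive a) d.partner_ne hx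

theorem concat_three_ends {x y z : Fin (2 * n)} (hx : capInv id a.partner x = x)
    (hy : capInv id a.partner y = y) (hz : capInv id a.partner z = z)
    (hxy : (concat d a).Reachable x y) (hxz : (concat d a).Reachable x z)
    (hyx : y ≠ x) (hzx : z ≠ x) : z = y := by
  rw [concat_eq] at hxy hxz
  exact eq_of_three_ends d.involutive (capInv_id_involutive a) d.partner_ne hx hy hz hxy hxz hyx hzx

theorem concat_three_left {i j k : Fin n}
    (hij : (concat d a).Reachable (leftPt i) (leftPt j))
    (hik : (concat d a).Reachable (leftPt i) (leftPt k)) (hji : j ≠ i) (hki : k ≠ i) : k = j :=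
  leftPt_inj.1 <| concat_three_ends d a (by simp) (by simp) (by simp) hij hik
    (mt leftPt_inj.1 hji) (mt leftPt_inj.1 hki)

open Classical in
/-- If the component of the left point `i` ends at the left point `j > i`, then the parity of the
number of its points below is constant on every other component. -/
theorem parityBelow_concat {i j : Fin n} (hij : i < j)
    (h : (concat d a).Reachable (leftPt i) (leftPt j)) :
    (∀ x y, (concat d a).Reachable x y → ¬ (concat d a).Reachable (leftPt i) x →
      parityBelow ((concat d a).Reachable (leftPt i)) x =
        parityBelow ((concat d a).Reachable (leftPt i)) y) ∧
    (∀ k, parityBelow ((concat d a).Reachable (leftPt i)) (leftPt k) =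
      if i < k ∧ k ≤ j then 1 else 0) ∧
    (∀ r, a.IsThrough r → ¬ (concat d a).Reachable (leftPt i) (rightPt r) →
      parityBelow ((concat d a).Reachable (leftPt i)) (rightPt r) = 0) := by
  set P := (concat d a).Reachable (leftPt i) with hP
  have hleft (m : Fin n) : P (leftPt m) ↔ m = i ∨ m = j := by
    constructor
    · intro hm
      by_contra! hne
      exact hne.2 (concat_three_left d a h hm hij.ne' hne.1)
    · rintro (rfl | rfl)
      exacts [SimpleGraph.Reachable.refl _, h]
  have hd (z) : (concat d a).Reachable z (d.partner z) := by
    rw [concat_eq]; exact reachable_left _ _ z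
  have hc (z) : (concat d a).Reachable z (capInv id a.partner z) := by
    rw [concat_eq]; exact reachable_right _ _ z
  have hnothrough (r : Fin n) (hr : P (rightPt r)) : ¬ a.IsThrough r := by
    intro hthr
    have := concat_three_ends d a (by simp) (by simp) (capInv_id_rightPt_eq.2 hthr) h hr
      (mt leftPt_inj.1 hij.ne') (leftPt_ne_rightPt _ _).symm
    exact leftPt_ne_rightPt _ _ this.symm
  -- Closing the path by joining its ends `i` and `j` makes `ρ` fixed-point-free on `P`: these ends
  -- leave no room for a through-string of `a`.
  set ρ := capInv (Equiv.swap i j) a.partner with hρdef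
  have hρ : ∀ z, P z → P (ρ z) ∧ ρ (ρ z) = z ∧ ρ z ≠ z := by
    intro z hz
    refine ⟨?_, capInv_involutive (Equiv.swap_apply_self _ _) a.involutive z, ?_⟩
    · rcases leftPt_or_rightPt z with ⟨m, rfl⟩ | ⟨m, rfl⟩
      · rw [hleft] at hz
        rw [hρdef, capInv_leftPt, hleft]
        rcases hz with rfl | rfl <;> simp
      · have := hc (rightPt m)
        rw [capInv_rightPt] at this
        rw [hρdef, capInv_rightPt]
        exact hz.trans this
    · rcases leftPt_or_rightPt z with ⟨m, rfl⟩ | ⟨m, rfl⟩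
      · rw [hleft] at hz
        rw [hρdef, capInv_leftPt, Ne, leftPt_inj]
        rcases hz with rfl | rfl
        · simpa using hij.ne'
        · simpa using hij.ne
      · rw [hρdef, capInv_rightPt, Ne, rightPt_inj]
        exact hnothrough m hz
  have hdinv (x : Fin (2 * n)) (hx : ¬ P x) : parityBelow P x = parityBelow P (d.partner x) := by
    have hlt (x : Fin (2 * n)) (hx : ¬ P x) (hxy : x < d.partner x) :
        parityBelow P x = parityBelow P (d.partner x) :=
      parityBelow_eq_of_lt d.partner hxy hx
        (fun z hz => ⟨hz.trans (hd z), d.partner_partner z, d.partner_ne z⟩)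
        (fun z _ h1 h2 => d.nested h1 h2 rfl)
    rcases lt_or_gt_of_ne (d.partner_ne x) with hlt' | hlt'
    · have := hlt (d.partner x) (fun h => hx (h.trans (hd x).symm))
        (by rwa [d.partner_partner])
      rw [d.partner_partner] at this
      exact this.symm
    · exact hlt x hx hlt'
  have hcinv (x : Fin (2 * n)) (hx : ¬ P x) :
      parityBelow P x = parityBelow P (capInv id a.partner x) := by
    rcases leftPt_or_rightPt x with ⟨u, rfl⟩ | ⟨u, rfl⟩
    · simp
    rw [capInv_rightPt]
    have hlt (u : Fin n) (hu : ¬ P (rightPt u)) (hlt : a.partner u < u) :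
        parityBelow P (rightPt u) = parityBelow P (rightPt (a.partner u)) := by
      refine parityBelow_eq_of_lt ρ (rightPt_lt_rightPt.2 hlt) hu hρ ?_
      intro z hz h1 h2
      -- Only right points lie between two right points, so here `ρ` is `a.partner` and nesting of
      -- arches of `a` applies.
      rcases leftPt_or_rightPt z with ⟨m, rfl⟩ | ⟨m, rfl⟩
      · exact absurd h1 (leftPt_lt_rightPt _ _).not_gt
      · rw [rightPt_lt_rightPt] at h1 h2
        rw [hρdef, capInv_rightPt, rightPt_lt_rightPt, rightPt_lt_rightPt]
        exact (a.nested h2 h1 (a.partner_partner u)).symm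
    rcases lt_trichotomy (a.partner u) u with h1 | h1 | h1
    · exact hlt u hx h1
    · rw [h1]
    · have h2 := hc (rightPt u)
      rw [capInv_rightPt] at h2
      have := hlt (a.partner u) (fun h => hx (h.trans h2.symm)) (by rwa [a.partner_partner])
      rw [a.partner_partner] at this
      exact this.symm
  refine ⟨?_, ?_, ?_⟩
  · intro x y hxy hx
    refine (reachable_closed d.involutive (capInv_id_involutive a)
      (P := fun z => ¬ P z ∧ parityBelow P x = parityBelow P z) ?_ ?_
      ((concat_eq d a) ▸ hxy) ⟨hx, rfl⟩).2
    · rintro z ⟨hz, he⟩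
      exact ⟨fun h => hz (h.trans (hd z).symm), he.trans (hdinv z hz)⟩
    · rintro z ⟨hz, he⟩
      exact ⟨fun h => hz (h.trans (hc z).symm), he.trans (hcinv z hz)⟩
  · intro k
    have hset : (Finset.univ.filter fun z => P z ∧ z < leftPt k) =
        (({i, j} : Finset (Fin n)).filter (· < k)).image leftPt := by
      ext z
      simp only [Finset.mem_filter, Finset.mem_univ, true_and, Finset.mem_image,
        Finset.mem_insert, Finset.mem_singleton]
      constructor
      · rintro ⟨hz, hlt⟩
        rcases leftPt_or_rightPt z with ⟨m, rfl⟩ | ⟨m, rfl⟩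
        · exact ⟨m, ⟨(hleft m).1 hz, hlt⟩, rfl⟩
        · exact absurd hlt (leftPt_lt_rightPt _ _).not_gt
      · rintro ⟨m, ⟨hm, hlt⟩, rfl⟩
        exact ⟨(hleft m).2 hm, hlt⟩
    rw [parityBelow, ← Finset.sum_filter, hset,
      Finset.sum_image (fun x _ y _ => leftPt_inj.1), Finset.sum_filter, Finset.sum_pair hij.ne]
    by_cases h1 : i < k
    · by_cases h2 : j < k
      · simp [h1, h2, h2.not_ge]; decide
      · simp [h1, h2, not_lt.1 h2]
    · have h2 : ¬ j < k := fun h => h1 (hij.trans h)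
      simp [h1, h2]
  · intro r hr hrP
    -- No arch of `a` passes over the through-string `r`, so `ρ` preserves the set of points of `P`
    -- below `rightPt r`.
    refine sum_pred_eq_zero _ ρ fun z hz => ⟨⟨(hρ z hz.1).1, ?_⟩, (hρ z hz.1).2⟩
    rcases leftPt_or_rightPt z with ⟨m, rfl⟩ | ⟨m, rfl⟩
    · rw [hρdef, capInv_leftPt]; exact leftPt_lt_rightPt _ _
    · have hlt := rightPt_lt_rightPt.1 hz.2
      rw [hρdef, capInv_rightPt, rightPt_lt_rightPt]
      by_contra! hle
      rcases hle.lt_or_eq with hlt' | heq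
      · exact a.through_outside _ _ _ hlt' hlt (a.partner_partner m) hr
      · have : m = r := by rw [← a.partner_partner m, heq]; exact hr
        exact hlt.ne this.symm

open Classical in
/-- The concatenation of a diagram with a half-diagram leaves behind a half-diagram. -/
theorem exists_isProduct : ∃ b, IsProduct d a b := by
  set R : Fin n → Fin n → Prop := fun i j => (concat d a).Reachable (leftPt i) (leftPt j) with hR
  have hRs {i j} (h : R i j) : R j i := SimpleGraph.Reachable.symm h
  set f : Fin n → Fin n := fun i => if h : ∃ j, i ≠ j ∧ R i j then h.choose else i with hf
  have hfspec (i j) (hij : i ≠ j) : f i = j ↔ R i j := by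
    by_cases h : ∃ j, i ≠ j ∧ R i j
    · have hfi : f i = h.choose := dif_pos h
      have hc := h.choose_spec
      rw [← hfi] at hc
      constructor
      · rintro rfl; exact hc.2
      · intro hj
        exact concat_three_left d a hj hc.2 hij.symm hc.1.symm
    · have hfi : f i = i := dif_neg h
      rw [hfi]
      exact ⟨fun e => absurd e hij, fun hj => absurd ⟨j, hij, hj⟩ h⟩
  refine ⟨⟨f, ?_, ?_, ?_⟩, hfspec⟩
  · intro i
    by_cases h : f i = i
    · rw [h, h]
    · exact (hfspec _ _ h).2 (hRs ((hfspec _ _ (Ne.symm h)).1 rfl))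
  · intro i k j l hik hkj hjl hi hk
    have hij := (hfspec _ _ (hik.trans hkj).ne).1 hi
    have hkl := (hfspec _ _ (hkj.trans hjl).ne).1 hk
    -- The parity is 1 at `k` and 0 at `l`, so no path avoiding the component of `i` joins them.
    obtain ⟨h1, h2, -⟩ := parityBelow_concat d a (hik.trans hkj) hij
    have hk' : ¬ (concat d a).Reachable (leftPt i) (leftPt k) := fun h =>
      hkj.ne (concat_three_left d a hij h (hik.trans hkj).ne' hik.ne')
    have := h1 _ _ hkl hk'
    rw [h2, h2, if_pos ⟨hik, hkj.le⟩, if_neg (fun h => hjl.not_ge h.2)] at this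
    exact one_ne_zero this
  · intro i k j hik hkj hi hk
    have hij := (hfspec _ _ (hik.trans hkj).ne).1 hi
    obtain ⟨h1, h2, h3⟩ := parityBelow_concat d a (hik.trans hkj) hij
    have hk' : ¬ (concat d a).Reachable (leftPt i) (leftPt k) := fun h =>
      hkj.ne (concat_three_left d a hij h (hik.trans hkj).ne' hik.ne')
    -- If `k` were unpaired, its path would end at a through-string of `a`, where the parity is 0,
    -- although it is 1 at `k`.
    obtain ⟨y, hy, hyt, hky, -⟩ := concat_other_end d a (x := leftPt k) (by simp)
    rcases leftPt_or_rightPt y with ⟨m, rfl⟩ | ⟨r, rfl⟩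
    · have hm : k ≠ m := fun e => hy (by rw [e])
      rw [(hfspec k m hm).2 hky] at hk
      exact hm hk.symm
    · have := h1 _ _ hky hk'
      rw [h2, if_pos ⟨hik, hkj.le⟩,
        h3 r (capInv_id_rightPt_eq.1 hyt) (fun h => hk' (h.trans hky.symm))] at this
      exact one_ne_zero this

end Concat

/-! ### Closures of diagrams and the adjoint property -/

theorem mem_supp_mk {V : Type*} {G : SimpleGraph V} {x v : V} :
    v ∈ (G.connectedComponentMk x).supp ↔ G.Reachable x v := by
  rw [SimpleGraph.ConnectedComponent.mem_supp_iff, SimpleGraph.ConnectedComponent.eq]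
  exact ⟨fun h => h.symm, fun h => h.symm⟩

theorem glue_eq (a b : HalfDiagram n) : glue a b = twoInv a.partner b.partner := rfl

theorem glue_closed {a b : HalfDiagram n} {P : Fin n → Prop} (h1 : ∀ x, P x → P (a.partner x))
    (h2 : ∀ x, P x → P (b.partner x)) {x y : Fin n} (h : (glue a b).Reachable x y) (hx : P x) :
    P y :=
  reachable_closed a.involutive b.involutive h1 h2 h hx

theorem concat_closed {d : Diagram n} {a : HalfDiagram n} {P : Fin (2 * n) → Prop}
    (h1 : ∀ x, P x → P (d.partner x)) (h2 : ∀ i, P (rightPt i) → P (rightPt (a.partner i)))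
    {x y : Fin (2 * n)} (h : (concat d a).Reachable x y) (hx : P x) : P y := by
  rw [concat_eq] at h
  refine reachable_closed d.involutive (capInv_id_involutive a) h1 ?_ h hx
  intro z hz
  rcases leftPt_or_rightPt z with ⟨i, rfl⟩ | ⟨i, rfl⟩
  · simpa using hz
  · simpa using h2 i hz

theorem concat_reachable_partner (d : Diagram n) (a : HalfDiagram n) (x : Fin (2 * n)) :
    (concat d a).Reachable x (d.partner x) := by
  rw [concat_eq]; exact reachable_left _ _ x

theorem concat_reachable_rightPt (d : Diagram n) (a : HalfDiagram n) (i : Fin n) :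
    (concat d a).Reachable (rightPt i) (rightPt (a.partner i)) := by
  rw [concat_eq, ← capInv_rightPt id]; exact reachable_right _ _ _

/-- A diagram closed off by half-diagrams on both sides. -/
def closure (b : HalfDiagram n) (d : Diagram n) (a : HalfDiagram n) : SimpleGraph (Fin (2 * n)) :=
  twoInv d.partner (capInv b.partner a.partner)

/-- Two through-strings on the same side of the closure are joined. -/
def ClosureJoinsThrough (b : HalfDiagram n) (d : Diagram n) (a : HalfDiagram n) : Prop :=
  (∃ i j, i ≠ j ∧ a.IsThrough i ∧ a.IsThrough j ∧
    (closure b d a).Reachable (rightPt i) (rightPt j)) ∨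
  (∃ i j, i ≠ j ∧ b.IsThrough i ∧ b.IsThrough j ∧
    (closure b d a).Reachable (leftPt i) (leftPt j))

/-- The number of closed loops of the closure. -/
def closureLoops (b : HalfDiagram n) (d : Diagram n) (a : HalfDiagram n) : ℕ :=
  Nat.card {C : (closure b d a).ConnectedComponent //
    ∀ i, (b.IsThrough i → leftPt i ∉ C.supp) ∧ (a.IsThrough i → rightPt i ∉ C.supp)}

open Classical in
/-- The common value of the two sides of the adjunction identity. -/
def closureValue (q : ℝ) (b : HalfDiagram n) (d : Diagram n) (a : HalfDiagram n) : ℂ :=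
  if ClosureJoinsThrough b d a then 0 else (q : ℂ) ^ closureLoops b d a

section Closure

variable {d : Diagram n} {a b a' : HalfDiagram n}

theorem closure_closed {P : Fin (2 * n) → Prop} (h1 : ∀ x, P x → P (d.partner x))
    (h2 : ∀ i, P (rightPt i) → P (rightPt (a.partner i)))
    (h3 : ∀ i, P (leftPt i) → P (leftPt (b.partner i)))
    {x y : Fin (2 * n)} (h : (closure b d a).Reachable x y) (hx : P x) : P y := by
  refine reachable_closed d.involutive (capInv_involutive b.involutive a.involutive) h1 ?_ h hx
  intro z hz
  rcases leftPt_or_rightPt z with ⟨i, rfl⟩ | ⟨i, rfl⟩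
  · simpa using h3 i hz
  · simpa using h2 i hz

theorem closure_reachable_partner (x : Fin (2 * n)) :
    (closure b d a).Reachable x (d.partner x) :=
  reachable_left _ _ x

theorem closure_reachable_rightPt (i : Fin n) :
    (closure b d a).Reachable (rightPt i) (rightPt (a.partner i)) := by
  rw [← capInv_rightPt b.partner]; exact reachable_right _ _ _

theorem closure_reachable_leftPt (i : Fin n) :
    (closure b d a).Reachable (leftPt i) (leftPt (b.partner i)) := by
  rw [← capInv_leftPt _ a.partner]; exact reachable_right _ _ _

theorem closure_of_concat {x y : Fin (2 * n)} (h : (concat d a).Reachable x y) :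
    (closure b d a).Reachable x y :=
  concat_closed (P := (closure b d a).Reachable x)
    (fun _ hz => hz.trans (closure_reachable_partner _))
    (fun _ hz => hz.trans (closure_reachable_rightPt _)) h (SimpleGraph.Reachable.refl _)

/-- The closure adds only arches of `b` between left points, so components away from the left side
do not change. -/
theorem concat_of_closure {x y : Fin (2 * n)} (hx : ∀ i, ¬ (concat d a).Reachable x (leftPt i))
    (h : (closure b d a).Reachable x y) : (concat d a).Reachable x y :=
  closure_closed (P := (concat d a).Reachable x)
    (fun _ hz => hz.trans (concat_reachable_partner _ _ _))
    (fun _ hz => hz.trans (concat_reachable_rightPt _ _ _))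
    (fun i hz => absurd hz (hx i)) h (SimpleGraph.Reachable.refl _)

theorem IsProduct.concat_reachable (h : IsProduct d a a') (i : Fin n) :
    (concat d a).Reachable (leftPt i) (leftPt (a'.partner i)) := by
  by_cases hi : i = a'.partner i
  · rw [← hi]
  · exact (h i _ hi).1 rfl

theorem IsProduct.glue_reachable (h : IsProduct d a a') {i j : Fin n}
    (hij : (concat d a).Reachable (leftPt i) (leftPt j)) : (glue a' b).Reachable i j := by
  by_cases hne : i = j
  · rw [hne]
  · rw [← (h i j hne).2 hij]; exact reachable_left _ _ i

/-- A path in the closure alternates between strands of the concatenation, recorded by `a'`, and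
arches of `b`; contracting the strands gives a path in the gluing. -/
theorem IsProduct.exists_of_closure (h : IsProduct d a a') {i : Fin n} {z : Fin (2 * n)}
    (hz : (closure b d a).Reachable (leftPt i) z) :
    ∃ k, (glue a' b).Reachable i k ∧ (concat d a).Reachable (leftPt k) z := by
  refine closure_closed
    (P := fun z => ∃ k, (glue a' b).Reachable i k ∧ (concat d a).Reachable (leftPt k) z)
    ?_ ?_ ?_ hz ⟨i, SimpleGraph.Reachable.refl _, SimpleGraph.Reachable.refl _⟩
  · rintro x ⟨k, h1, h2⟩; exact ⟨k, h1, h2.trans (concat_reachable_partner _ _ _)⟩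
  · rintro x ⟨k, h1, h2⟩; exact ⟨k, h1, h2.trans (concat_reachable_rightPt _ _ _)⟩
  · rintro m ⟨k, h1, h2⟩
    exact ⟨b.partner m, (h1.trans (h.glue_reachable h2)).trans (reachable_right _ _ m),
      SimpleGraph.Reachable.refl _⟩

theorem IsProduct.closure_reachable_iff (h : IsProduct d a a') {i j : Fin n} :
    (closure b d a).Reachable (leftPt i) (leftPt j) ↔ (glue a' b).Reachable i j := by
  constructor
  · intro hij
    obtain ⟨k, h1, h2⟩ := h.exists_of_closure hij
    exact h1.trans (h.glue_reachable h2)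
  · intro hij
    refine glue_closed (P := fun k => (closure b d a).Reachable (leftPt i) (leftPt k)) ?_ ?_ hij
      (SimpleGraph.Reachable.refl _)
    · intro x hx; exact hx.trans (closure_of_concat (h.concat_reachable x))
    · intro x hx; exact hx.trans (closure_reachable_leftPt x)

/-- The path from a left point has exactly one other end: a left point, giving an arch of `a'`, or a
through-string of `a`. -/
theorem IsProduct.isThrough_iff (h : IsProduct d a a') {i : Fin n} :
    a'.IsThrough i ↔ ∃ r, a.IsThrough r ∧ (concat d a).Reachable (leftPt i) (rightPt r) := by
  constructor
  · intro hi
    obtain ⟨y, hy, hyt, hr, -⟩ := concat_other_end d a (x := leftPt i) (by simp)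
    rcases leftPt_or_rightPt y with ⟨m, rfl⟩ | ⟨r, rfl⟩
    · have hm : i ≠ m := fun e => hy (by rw [e])
      have := (h i m hm).2 hr
      exact absurd (hi.symm.trans this) hm
    · exact ⟨r, capInv_id_rightPt_eq.1 hyt, hr⟩
  · rintro ⟨r, hr, hir⟩
    by_contra hi
    exact leftPt_ne_rightPt _ _ <| concat_three_ends d a (by simp) (capInv_id_rightPt_eq.2 hr)
      (by simp) hir (h.concat_reachable i) (leftPt_ne_rightPt _ _).symm (mt leftPt_inj.1 hi)

theorem exists_left_end (hJ : ¬ JoinsThrough d a) {r : Fin n} (hr : a.IsThrough r) :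
    ∃ i, (concat d a).Reachable (rightPt r) (leftPt i) := by
  obtain ⟨y, hy, hyt, hry, -⟩ := concat_other_end d a (capInv_id_rightPt_eq.2 hr)
  rcases leftPt_or_rightPt y with ⟨i, rfl⟩ | ⟨s, rfl⟩
  · exact ⟨i, hry⟩
  · exact absurd ⟨r, s, fun e => hy (by rw [e]), hr, capInv_id_rightPt_eq.1 hyt, hry⟩ hJ

theorem IsProduct.closureJoinsThrough_iff (h : IsProduct d a a') (hJ : ¬ JoinsThrough d a) :
    ClosureJoinsThrough b d a ↔ GlueJoinsThrough a' b := by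
  constructor
  · rintro (⟨r, s, hrs, hr, hs, hR⟩ | ⟨i, j, hij, hi, hj, hR⟩)
    · obtain ⟨i, hi⟩ := exists_left_end hJ hr
      obtain ⟨j, hj⟩ := exists_left_end hJ hs
      refine ⟨i, j, ?_, ?_, Or.inl ⟨h.isThrough_iff.2 ⟨r, hr, hi.symm⟩,
        h.isThrough_iff.2 ⟨s, hs, hj.symm⟩⟩⟩
      · rintro rfl
        exact hJ ⟨r, s, hrs, hr, hs, hi.trans hj.symm⟩
      · rw [← h.closure_reachable_iff (b := b)]
        exact ((closure_of_concat hi).symm.trans hR).trans (closure_of_concat hj)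
    · exact ⟨i, j, hij, h.closure_reachable_iff.1 hR, Or.inr ⟨hi, hj⟩⟩
  · rintro ⟨i, j, hij, hR, ⟨hi, hj⟩ | ⟨hi, hj⟩⟩
    · obtain ⟨r, hr, hir⟩ := h.isThrough_iff.1 hi
      obtain ⟨s, hs, hjs⟩ := h.isThrough_iff.1 hj
      refine Or.inl ⟨r, s, ?_, hr, hs, ?_⟩
      · rintro rfl
        have := (h i j hij).2 (hir.trans hjs.symm)
        exact hij (hi.symm.trans this)
      · exact ((closure_of_concat hir).symm.trans (h.closure_reachable_iff.2 hR)).trans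
          (closure_of_concat hjs)
    · exact Or.inr ⟨i, j, hij, hi, hj, h.closure_reachable_iff.2 hR⟩

/-- Loops of the closure missing the left side are the loops removed in forming the product; those
meeting it are the loops of the gluing of `a'` with `b`. -/
theorem IsProduct.closureLoops_eq (h : IsProduct d a a') :
    closureLoops b d a = concatLoops d a + glueLoops a' b := by
  set S : (closure b d a).ConnectedComponent → Prop := fun C =>
    ∀ i, (b.IsThrough i → leftPt i ∉ C.supp) ∧ (a.IsThrough i → rightPt i ∉ C.supp) with hS
  have hsplit : Nat.card {C // S C} =
      Nat.card {C // S C ∧ ∀ i, leftPt i ∉ C.supp} +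
      Nat.card {C // S C ∧ ∃ i, leftPt i ∈ C.supp} := by
    classical
    rw [← Nat.card_sum]
    refine Nat.card_congr ((Equiv.subtypeEquivRight fun C => ?_).trans
      (subtypeOrEquiv _ _ ?_))
    · rw [← and_or_left]
      refine (and_iff_left ?_).symm
      by_cases hC : ∃ i, leftPt i ∈ C.supp
      · exact Or.inr hC
      · exact Or.inl (not_exists.1 hC)
    · rw [Pi.disjoint_iff]
      intro C
      rw [Prop.disjoint_iff, not_and_or]
      by_cases hC : ∃ i, leftPt i ∈ C.supp
      · obtain ⟨i, hi⟩ := hC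
        exact Or.inl fun h => h.2 i hi
      · exact Or.inr fun h => hC h.2
  rw [closureLoops, hsplit]
  congr 1
  · symm
    refine card_components_eq id ?_ ?_ ?_
    · intro x y hx hy
      refine ⟨closure_of_concat, concat_of_closure fun i hi => (hx i).1 (mem_supp_mk.2 hi)⟩
    · intro x hx
      have hc {z} (hz : (closure b d a).Reachable x z) : (concat d a).Reachable x z :=
        concat_of_closure (fun i hi => (hx i).1 (mem_supp_mk.2 hi)) hz
      refine ⟨fun i => ⟨fun _ hm => ?_, fun ht hm => ?_⟩, fun i hm => ?_⟩
      · exact (hx i).1 (mem_supp_mk.2 (hc (mem_supp_mk.1 hm)))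
      · exact (hx i).2 ht (mem_supp_mk.2 (hc (mem_supp_mk.1 hm)))
      · exact (hx i).1 (mem_supp_mk.2 (hc (mem_supp_mk.1 hm)))
    · rintro w ⟨h1, h2⟩
      refine ⟨w, fun i => ⟨fun hm => ?_, fun ht hm => ?_⟩, SimpleGraph.Reachable.refl _⟩
      · exact h2 i (mem_supp_mk.2 (closure_of_concat (mem_supp_mk.1 hm)))
      · exact (h1 i).2 ht (mem_supp_mk.2 (closure_of_concat (mem_supp_mk.1 hm)))
  · symm
    refine card_components_eq leftPt ?_ ?_ ?_
    · intro i j _ _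
      exact h.closure_reachable_iff.symm
    · intro i hi
      refine ⟨fun k => ⟨fun ht hm => ?_, fun ht hm => ?_⟩,
        i, mem_supp_mk.2 (SimpleGraph.Reachable.refl _)⟩
      · exact (hi k (mem_supp_mk.2 (h.closure_reachable_iff.1 (mem_supp_mk.1 hm)))).2 ht
      · obtain ⟨m, h1, h2⟩ := h.exists_of_closure (mem_supp_mk.1 hm)
        exact (hi m (mem_supp_mk.2 h1)).1 (h.isThrough_iff.2 ⟨k, ht, h2⟩)
    · rintro w ⟨h1, i, hi⟩
      have hw := mem_supp_mk.1 hi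
      refine ⟨i, fun k hk => ?_, hw.symm⟩
      have hk' := hw.trans (h.closure_reachable_iff.2 (mem_supp_mk.1 hk))
      refine ⟨fun ht => ?_, fun ht => (h1 k).1 ht (mem_supp_mk.2 hk')⟩
      obtain ⟨r, hr, hkr⟩ := h.isThrough_iff.1 ht
      exact (h1 r).2 hr (mem_supp_mk.2 (hk'.trans (closure_of_concat hkr)))

theorem IsProduct.closureValue_eq (q : ℝ) (h : IsProduct d a a') (hJ : ¬ JoinsThrough d a) :
    closureValue q b d a = (q : ℂ) ^ concatLoops d a * formBasis q a' b := by
  rw [closureValue, formBasis, h.closureJoinsThrough_iff hJ, h.closureLoops_eq]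
  split_ifs
  · rw [mul_zero]
  · rw [pow_add]

theorem closureValue_eq_zero (q : ℝ) (hJ : JoinsThrough d a) : closureValue q b d a = 0 := by
  obtain ⟨i, j, hij, hi, hj, hR⟩ := hJ
  exact if_pos (Or.inl ⟨i, j, hij, hi, hj, closure_of_concat hR⟩)

theorem transpose_transpose (d : Diagram n) : d.transpose.transpose = d := by
  ext1; funext i; simp [Diagram.transpose]

theorem transpose_partner_rev (d : Diagram n) (x : Fin (2 * n)) :
    d.transpose.partner x.rev = (d.partner x).rev := by
  simp [Diagram.transpose]

theorem closure_transpose_reachable {x y : Fin (2 * n)} :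
    (closure a d.transpose b).Reachable x.rev y.rev ↔ (closure b d a).Reachable x y := by
  have key (d : Diagram n) (a b : HalfDiagram n) (x y : Fin (2 * n))
      (h : (closure b d a).Reachable x y) :
      (closure a d.transpose b).Reachable x.rev y.rev := by
    refine closure_closed (P := fun z => (closure a d.transpose b).Reachable x.rev z.rev)
      ?_ ?_ ?_ h (SimpleGraph.Reachable.refl _)
    · intro z hz; rw [← transpose_partner_rev]; exact hz.trans (closure_reachable_partner _)
    · intro i hi; rw [rev_rightPt] at *; exact hi.trans (closure_reachable_leftPt _)
    · intro i hi; rw [rev_leftPt] at *; exact hi.trans (closure_reachable_rightPt _)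
  refine ⟨fun h => ?_, key d a b x y⟩
  have := key d.transpose b a _ _ h
  rwa [transpose_transpose, Fin.rev_rev, Fin.rev_rev] at this

theorem closureValue_transpose (q : ℝ) :
    closureValue q a d.transpose b = closureValue q b d a := by
  have hJ : ClosureJoinsThrough a d.transpose b ↔ ClosureJoinsThrough b d a := by
    rw [ClosureJoinsThrough, ClosureJoinsThrough, or_comm]
    simp only [← closure_transpose_reachable (d := d) (a := a) (b := b), rev_leftPt, rev_rightPt]
  have hL : closureLoops b d a = closureLoops a d.transpose b := by
    refine card_components_eq Fin.rev ?_ ?_ ?_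
    · intro x y _ _; exact closure_transpose_reachable.symm
    · intro x hx i
      simp only [mem_supp_mk] at hx ⊢
      refine ⟨fun ht h => (hx i).2 ht ?_, fun ht h => (hx i).1 ht ?_⟩
      · rwa [← closure_transpose_reachable, rev_rightPt]
      · rwa [← closure_transpose_reachable, rev_leftPt]
    · intro w hw
      obtain ⟨v, rfl⟩ := Fin.rev_surjective w
      refine ⟨v, fun i => ?_, SimpleGraph.Reachable.refl _⟩
      simp only [mem_supp_mk] at hw ⊢
      refine ⟨fun ht h => (hw i).2 ht ?_, fun ht h => (hw i).1 ht ?_⟩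
      · rwa [← closure_transpose_reachable, rev_leftPt] at h
      · rwa [← closure_transpose_reachable, rev_rightPt] at h
  rw [closureValue, closureValue, hJ, hL]

end Closure

open Classical in
theorem actBasis_of_isProduct {d : Diagram n} {a b : HalfDiagram n} (q : ℝ)
    (hJ : ¬ JoinsThrough d a) (h : IsProduct d a b) :
    actBasis q d a = (q : ℂ) ^ concatLoops d a • xi b := by
  rw [actBasis, if_neg hJ, Finset.sum_eq_single b, if_pos h]
  · intro c _ hc
    exact if_neg fun hc' => hc (hc'.unique h)
  · simp

theorem actBasis_of_joinsThrough {d : Diagram n} {a : HalfDiagram n} (q : ℝ)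
    (hJ : JoinsThrough d a) : actBasis q d a = 0 := by
  rw [actBasis, if_pos hJ]

theorem diagramForm_xi (q : ℝ) (a b : HalfDiagram n) :
    diagramForm n q (xi a) (xi b) = formBasis q a b := by
  classical
  simp only [diagramForm, LinearMap.mk₂'ₛₗ_apply]
  rw [Finset.sum_eq_single a, Finset.sum_eq_single b]
  · simp
  · intro c _ hc; simp [hc.symm]
  · simp
  · intro c _ hc; simp [hc.symm]
  · simp

theorem diagramForm_actBasis (q : ℝ) (d : Diagram n) (a b : HalfDiagram n) :
    diagramForm n q (actBasis q d a) (xi b) = closureValue q b d a := by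
  by_cases hJ : JoinsThrough d a
  · rw [actBasis_of_joinsThrough q hJ, closureValue_eq_zero q hJ, map_zero,
      LinearMap.zero_apply]
  · obtain ⟨c, hc⟩ := exists_isProduct d a
    rw [actBasis_of_isProduct q hJ hc, hc.closureValue_eq q hJ, map_smul, LinearMap.smul_apply,
      diagramForm_xi, smul_eq_mul]

theorem glue_comm (a b : HalfDiagram n) : glue a b = glue b a := twoInv_comm _ _

theorem formBasis_comm (q : ℝ) (a b : HalfDiagram n) : formBasis q a b = formBasis q b a := by
  have hJ : GlueJoinsThrough a b ↔ GlueJoinsThrough b a := by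
    simp only [GlueJoinsThrough, glue_comm a b]
    simp only [or_comm]
  have hL : glueLoops a b = glueLoops b a := by
    simp only [glueLoops]
    rw [glue_comm a b]
    simp only [and_comm]
  rw [formBasis, formBasis, hJ, hL]

theorem conj_formBasis (q : ℝ) (a b : HalfDiagram n) :
    conj (formBasis q a b) = formBasis q a b := by
  rw [formBasis]; split_ifs <;> simp

theorem diagramForm_conj_symm (q : ℝ) (x y : U n) :
    conj (diagramForm n q x y) = diagramForm n q y x := by
  simp only [diagramForm, LinearMap.mk₂'ₛₗ_apply, map_sum, map_mul, Complex.conj_conj,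
    conj_formBasis]
  rw [Finset.sum_comm]
  refine Finset.sum_congr rfl fun a _ => Finset.sum_congr rfl fun b _ => ?_
  rw [formBasis_comm q b a]; ring

theorem conj_closureValue (q : ℝ) (b : HalfDiagram n) (d : Diagram n) (a : HalfDiagram n) :
    conj (closureValue q b d a) = closureValue q b d a := by
  rw [closureValue]; split_ifs <;> simp

/-- The adjunction property need only be checked on basis vectors. -/
theorem isStarAdjoint_iff (q : ℝ) (B : SesqForm n) :
    IsStarAdjoint q B ↔ ∀ d a b,
      B (actBasis q d a) (xi b) = B (xi a) (actBasis q d.transpose b) := by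
  have hact (d : Diagram n) (a : HalfDiagram n) (s t : ℂ) :
      act n q (Finsupp.single d s) (Finsupp.single a t) = s • t • actBasis q d a := by
    simp [act, Finsupp.linearCombination_single]
  have hstar (d : Diagram n) (s : ℂ) :
      tlStar (Finsupp.single d s) = Finsupp.single d.transpose (conj s) := by
    simp [tlStar]
  have hstar_add (e e' : TL n) : tlStar (e + e') = tlStar e + tlStar e' :=
    Finsupp.sum_add_index' (by simp) (by simp)
  constructor
  · intro h d a b
    have := h (Finsupp.single d 1) (xi a) (xi b)
    simpa [hact, hstar] using this
  · intro h e x y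
    induction e using Finsupp.induction_linear with
    | zero => simp [tlStar]
    | add e e' he he' => simp [hstar_add, he, he']
    | single d s =>
      induction x using Finsupp.induction_linear with
      | zero => simp
      | add x x' hx hx' => simp [hx, hx']
      | single a t =>
        induction y using Finsupp.induction_linear with
        | zero => simp
        | add y y' hy hy' => simp only [map_add, hy, hy']
        | single b u =>
          have ha : Finsupp.single a t = t • xi a := by simp
          have hb : Finsupp.single b u = u • xi b := by simp
          rw [hstar, hact, hact, ha, hb]
          simp only [map_smul, LinearMap.smul_apply, LinearMap.map_smulₛₗ, h, smul_eq_mul,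
            Complex.conj_conj]
          ring

theorem isStarAdjoint_diagramForm (q : ℝ) : IsStarAdjoint q (diagramForm n q) := by
  rw [isStarAdjoint_iff]
  intro d a b
  rw [diagramForm_actBasis, ← diagramForm_conj_symm, diagramForm_actBasis, conj_closureValue,
    closureValue_transpose]

/-! ### Counting pairs and through-strings -/

theorem two_mul_numPairs_add (a : HalfDiagram n) :
    2 * a.numPairs + Nat.card {i // a.partner i = i} = n := by
  have h1 : (Finset.univ.filter fun i => a.partner i < i).card = a.numPairs := by
    refine Finset.card_bij' (fun i _ => a.partner i) (fun i _ => a.partner i) ?_ ?_ ?_ ?_ <;>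
      simp [a.partner_partner]
  have h2 : Nat.card {i // a.partner i = i} =
      (Finset.univ.filter fun i => ¬ i < a.partner i ∧ ¬ a.partner i < i).card := by
    rw [Nat.card_eq_fintype_card, Fintype.card_subtype]
    congr 1
    ext i
    simp only [Finset.mem_filter, Finset.mem_univ, true_and, not_lt]
    exact ⟨fun h => ⟨h.le, h.ge⟩, fun h => le_antisymm h.1 h.2⟩
  have h3 := Finset.card_filter_add_card_filter_not (s := Finset.univ)
    (fun i => i < a.partner i)
  have h4 := Finset.card_filter_add_card_filter_not
    (s := Finset.univ.filter fun i => ¬ i < a.partner i) (fun i => a.partner i < i)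
  have h5 : (Finset.univ.filter fun i => ¬ i < a.partner i).filter (fun i => a.partner i < i) =
      Finset.univ.filter fun i => a.partner i < i := by
    ext i; simpa using fun h : a.partner i < i => h.le
  rw [h5, Finset.filter_filter] at h4
  rw [Finset.card_univ, Fintype.card_fin] at h3
  rw [HalfDiagram.numPairs] at *
  omega

theorem numPairs_le_iff {a b : HalfDiagram n} : a.numPairs ≤ b.numPairs ↔
    Nat.card {i // b.partner i = i} ≤ Nat.card {i // a.partner i = i} := by
  have := two_mul_numPairs_add a
  have := two_mul_numPairs_add b
  omega

/-- When no through-strings of `a` meet, following each to its left end is a bijection onto the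
through-strings of `b`. Hence the action preserves each `U(n; p)`. -/
theorem IsProduct.numPairs_eq {d : Diagram n} {a b : HalfDiagram n} (h : IsProduct d a b)
    (hJ : ¬ JoinsThrough d a) : b.numPairs = a.numPairs := by
  choose f hf using fun r : {r // a.partner r = r} => exists_left_end hJ r.2
  have hcard : Nat.card {i // a.partner i = i} = Nat.card {i // b.partner i = i} := by
    refine Nat.card_eq_of_bijective
      (fun r => ⟨f r, h.isThrough_iff.2 ⟨r, r.2, (hf r).symm⟩⟩) ⟨?_, ?_⟩
    · intro r s hrs
      have hrs : f r = f s := Subtype.ext_iff.1 hrs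
      by_contra hne
      exact hJ ⟨r, s, fun e => hne (Subtype.ext e), r.2, s.2, (hf r).trans (hrs ▸ (hf s).symm)⟩
    · rintro ⟨i, hi⟩
      obtain ⟨r, hr, hir⟩ := h.isThrough_iff.1 hi
      refine ⟨⟨r, hr⟩, Subtype.ext ?_⟩
      exact leftPt_inj.1 <| concat_three_ends d a (capInv_id_rightPt_eq.2 hr) (by simp) (by simp)
        hir.symm (hf ⟨r, hr⟩) (leftPt_ne_rightPt _ _) (leftPt_ne_rightPt _ _)
  have := two_mul_numPairs_add a
  have := two_mul_numPairs_add b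
  omega

/-! ### Bridge diagrams as rank one operators -/

section Bridge

variable {a b c : HalfDiagram n}

open Classical in
/-- The partner map of `bridge`. -/
def bridgeFun (φ : {i // a.partner i = i} ≃o {i // b.partner i = i}) :
    Fin (2 * n) → Fin (2 * n) :=
  sideCases (fun i => if h : a.partner i = i then rightPt (φ ⟨i, h⟩) else leftPt (a.partner i))
    (fun i => if h : b.partner i = i then leftPt (φ.symm ⟨i, h⟩) else rightPt (b.partner i))

variable (φ : {i // a.partner i = i} ≃o {i // b.partner i = i})

theorem bridgeFun_leftPt_of_through {i : Fin n} (h : a.partner i = i) :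
    bridgeFun φ (leftPt i) = rightPt (φ ⟨i, h⟩) := by
  simp [bridgeFun, h]

theorem bridgeFun_leftPt_of_ne {i : Fin n} (h : a.partner i ≠ i) :
    bridgeFun φ (leftPt i) = leftPt (a.partner i) := by
  simp [bridgeFun, h]

theorem bridgeFun_rightPt_of_through {i : Fin n} (h : b.partner i = i) :
    bridgeFun φ (rightPt i) = leftPt (φ.symm ⟨i, h⟩) := by
  simp [bridgeFun, h]

theorem bridgeFun_rightPt_of_ne {i : Fin n} (h : b.partner i ≠ i) :
    bridgeFun φ (rightPt i) = rightPt (b.partner i) := by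
  simp [bridgeFun, h]

theorem HalfDiagram.partner_partner_ne (a : HalfDiagram n) {i : Fin n} (h : a.partner i ≠ i) :
    a.partner (a.partner i) ≠ a.partner i := by
  rw [a.partner_partner]; exact h.symm

theorem bridgeFun_left_left {i j : Fin n} (h : bridgeFun φ (leftPt i) = leftPt j) :
    a.partner i = j := by
  by_cases hi : a.partner i = i
  · rw [bridgeFun_leftPt_of_through φ hi] at h
    exact absurd h.symm (leftPt_ne_rightPt _ _)
  · rwa [bridgeFun_leftPt_of_ne φ hi, leftPt_inj] at h

theorem bridgeFun_right_right {i j : Fin n} (h : bridgeFun φ (rightPt i) = rightPt j) :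
    b.partner i = j := by
  by_cases hi : b.partner i = i
  · rw [bridgeFun_rightPt_of_through φ hi] at h
    exact absurd h (leftPt_ne_rightPt _ _)
  · rwa [bridgeFun_rightPt_of_ne φ hi, rightPt_inj] at h

theorem bridgeFun_left_right {i j : Fin n} (h : bridgeFun φ (leftPt i) = rightPt j) :
    ∃ hi : a.partner i = i, ∃ hj : b.partner j = j, φ ⟨i, hi⟩ = ⟨j, hj⟩ := by
  by_cases hi : a.partner i = i
  · rw [bridgeFun_leftPt_of_through φ hi, rightPt_inj] at h
    exact ⟨hi, h ▸ (φ ⟨i, hi⟩).2, Subtype.ext h⟩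
  · rw [bridgeFun_leftPt_of_ne φ hi] at h
    exact absurd h (leftPt_ne_rightPt _ _)

/-- The diagram with `a` on the left and `b` on the right, whose through-strings are joined in
order. -/
def bridge : Diagram n where
  partner := bridgeFun φ
  partner_partner x := by
    rcases leftPt_or_rightPt x with ⟨i, rfl⟩ | ⟨i, rfl⟩
    · by_cases h : a.partner i = i
      · rw [bridgeFun_leftPt_of_through φ h, bridgeFun_rightPt_of_through φ (φ ⟨i, h⟩).2]
        simp
      · rw [bridgeFun_leftPt_of_ne φ h, bridgeFun_leftPt_of_ne φ (a.partner_partner_ne h),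
          a.partner_partner]
    · by_cases h : b.partner i = i
      · rw [bridgeFun_rightPt_of_through φ h,
          bridgeFun_leftPt_of_through φ (φ.symm ⟨i, h⟩).2]
        simp
      · rw [bridgeFun_rightPt_of_ne φ h, bridgeFun_rightPt_of_ne φ (b.partner_partner_ne h),
          b.partner_partner]
  partner_ne x := by
    rcases leftPt_or_rightPt x with ⟨i, rfl⟩ | ⟨i, rfl⟩
    · by_cases h : a.partner i = i
      · rw [bridgeFun_leftPt_of_through φ h]; exact (leftPt_ne_rightPt _ _).symm
      · rwa [bridgeFun_leftPt_of_ne φ h, Ne, leftPt_inj]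
    · by_cases h : b.partner i = i
      · rw [bridgeFun_rightPt_of_through φ h]; exact leftPt_ne_rightPt _ _
      · rwa [bridgeFun_rightPt_of_ne φ h, Ne, rightPt_inj]
  noncrossing i k j l hik hkj hjl hi hk := by
    have hlr {i j : Fin n} (h : rightPt i < leftPt j) : False := (leftPt_lt_rightPt j i).not_gt h
    rcases leftPt_or_rightPt l with ⟨l, rfl⟩ | ⟨l, rfl⟩
    · rcases leftPt_or_rightPt j with ⟨j, rfl⟩ | ⟨j, rfl⟩
      · rcases leftPt_or_rightPt k with ⟨k, rfl⟩ | ⟨k, rfl⟩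
        · rcases leftPt_or_rightPt i with ⟨i, rfl⟩ | ⟨i, rfl⟩
          · exact a.noncrossing i k j l hik hkj hjl (bridgeFun_left_left φ hi)
              (bridgeFun_left_left φ hk)
          · exact hlr hik
        · exact hlr hkj
      · exact hlr hjl
    rcases leftPt_or_rightPt i with ⟨i, rfl⟩ | ⟨i, rfl⟩
    · rcases leftPt_or_rightPt k with ⟨k, rfl⟩ | ⟨k, rfl⟩
      · obtain ⟨hkk, hll, hkl⟩ := bridgeFun_left_right φ hk
        rcases leftPt_or_rightPt j with ⟨j, rfl⟩ | ⟨j, rfl⟩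
        · exact a.through_outside i k j hik hkj (bridgeFun_left_left φ hi) hkk
        · obtain ⟨hii, hjj, hij⟩ := bridgeFun_left_right φ hi
          -- Right points run in the opposite order, so monotonicity of `φ` is exactly what keeps
          -- two through-strands from crossing.
          have h1 : (⟨i, hii⟩ : {i // a.partner i = i}) < ⟨k, hkk⟩ := hik
          rw [← φ.lt_iff_lt, hij, hkl] at h1
          exact (rightPt_lt_rightPt.1 hjl).not_gt h1
      · rcases leftPt_or_rightPt j with ⟨j, rfl⟩ | ⟨j, rfl⟩
        · exact hlr hkj
        · obtain ⟨-, hjj, -⟩ := bridgeFun_left_right φ hi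
          have hkl := bridgeFun_right_right φ hk
          refine b.through_outside l j k (rightPt_lt_rightPt.1 hjl) (rightPt_lt_rightPt.1 hkj)
            ?_ hjj
          rw [← hkl, b.partner_partner]
    · rcases leftPt_or_rightPt k with ⟨k, rfl⟩ | ⟨k, rfl⟩
      · exact hlr hik
      · rcases leftPt_or_rightPt j with ⟨j, rfl⟩ | ⟨j, rfl⟩
        · exact hlr hkj
        · have hij := bridgeFun_right_right φ hi
          have hkl := bridgeFun_right_right φ hk
          refine b.noncrossing l j k i (rightPt_lt_rightPt.1 hjl) (rightPt_lt_rightPt.1 hkj)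
            (rightPt_lt_rightPt.1 hik) ?_ ?_
          · rw [← hkl, b.partner_partner]
          · rw [← hij, b.partner_partner]

theorem bridge_transpose : (bridge φ).transpose = bridge φ.symm := by
  ext1
  funext x
  change (bridgeFun φ x.rev).rev = bridgeFun φ.symm x
  rcases leftPt_or_rightPt x with ⟨i, rfl⟩ | ⟨i, rfl⟩
  · rw [rev_leftPt]
    by_cases h : b.partner i = i
    · rw [bridgeFun_rightPt_of_through φ h, bridgeFun_leftPt_of_through φ.symm h, rev_leftPt]
    · rw [bridgeFun_rightPt_of_ne φ h, bridgeFun_leftPt_of_ne φ.symm h, rev_rightPt]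
  · rw [rev_rightPt]
    by_cases h : a.partner i = i
    · rw [bridgeFun_leftPt_of_through φ h, bridgeFun_rightPt_of_through φ.symm h, rev_rightPt,
        OrderIso.symm_symm]
    · rw [bridgeFun_leftPt_of_ne φ h, bridgeFun_rightPt_of_ne φ.symm h, rev_leftPt]

theorem bridge_reachable_of_glue {i j : Fin n} (h : (glue c b).Reachable i j) :
    (concat (bridge φ) c).Reachable (rightPt i) (rightPt j) := by
  refine glue_closed (P := fun k => (concat (bridge φ) c).Reachable (rightPt i) (rightPt k))
    ?_ ?_ h (SimpleGraph.Reachable.refl _)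
  · intro k hk; exact hk.trans (concat_reachable_rightPt _ _ _)
  · intro k hk
    by_cases hb : b.partner k = k
    · rwa [hb]
    · rw [← bridgeFun_rightPt_of_ne φ hb]
      exact hk.trans (concat_reachable_partner (bridge φ) c _)

theorem bridge_reachable_through (i : {i // a.partner i = i}) :
    (concat (bridge φ) c).Reachable (leftPt i.1) (rightPt (φ i).1) := by
  rw [← bridgeFun_leftPt_of_through φ i.2]
  exact concat_reachable_partner (bridge φ) c _

/-- If the through-strings are not joined in the gluing, they match up. -/
theorem card_through_le_of_not_glueJoinsThrough (h : ¬ GlueJoinsThrough a b) :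
    Nat.card {i // b.partner i = i} ≤ Nat.card {i // a.partner i = i} ∧
      ∀ i, b.partner i = i → ∃ j, a.partner j = j ∧ (glue a b).Reachable i j := by
  have hsep := separated_of_card_le a.involutive b.involutive fun x y hx hy hxy => by
    by_contra hne
    exact h ⟨x, y, hne, hxy, Or.inr ⟨hx, hy⟩⟩
  exact ⟨hsep.1, hsep.2.1⟩

theorem glueJoinsThrough_comm : GlueJoinsThrough a b ↔ GlueJoinsThrough b a := by
  simp only [GlueJoinsThrough, glue_comm a b]
  simp only [or_comm]

theorem numPairs_eq_of_not_glueJoinsThrough (h : ¬ GlueJoinsThrough a b) :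
    a.numPairs = b.numPairs :=
  le_antisymm (numPairs_le_iff.2 (card_through_le_of_not_glueJoinsThrough h).1)
    (numPairs_le_iff.2 (card_through_le_of_not_glueJoinsThrough
      (mt glueJoinsThrough_comm.2 h)).1)

theorem formBasis_eq_zero (q : ℝ) (h : a.numPairs ≠ b.numPairs) : formBasis q a b = 0 :=
  if_pos (by_contra fun hJ => h (numPairs_eq_of_not_glueJoinsThrough hJ))

/-- The delicate case is a gluing that joins through-strings of `b` but none of `c`. By `hle`, `c`
has at least as many through-strings as `b`, so `separated_of_card_le` excludes it. -/
theorem joinsThrough_bridge (hle : c.numPairs ≤ b.numPairs) (h : GlueJoinsThrough c b) :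
    JoinsThrough (bridge φ) c := by
  by_contra hJ
  have hsep : ∀ x y, c.partner x = x → c.partner y = y → (glue c b).Reachable x y → x = y := by
    intro x y hx hy hxy
    by_contra hne
    exact hJ ⟨x, y, hne, hx, hy, bridge_reachable_of_glue φ hxy⟩
  rw [glue_comm, glue_eq] at hsep
  obtain ⟨-, -, h3⟩ := separated_of_card_le b.involutive c.involutive hsep
  obtain ⟨i, j, hij, hR, ⟨hi, hj⟩ | ⟨hi, hj⟩⟩ := h
  · exact hij (hsep i j hi hj (by rwa [glue_comm] at hR))
  · exact hij (h3 (numPairs_le_iff.1 hle) i j hi hj (by rwa [glue_comm] at hR))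

theorem bridge_right_left (h : ¬ GlueJoinsThrough c b) {r : Fin n} (hr : c.IsThrough r) :
    ∃ i, (concat (bridge φ) c).Reachable (rightPt r) (leftPt i) := by
  obtain ⟨s, hs, hrs⟩ := (card_through_le_of_not_glueJoinsThrough
    (mt glueJoinsThrough_comm.2 h)).2 r hr
  rw [glue_comm] at hrs
  refine ⟨φ.symm ⟨s, hs⟩, (bridge_reachable_of_glue φ hrs).trans ?_⟩
  have := bridge_reachable_through (c := c) φ (φ.symm ⟨s, hs⟩)
  rw [OrderIso.apply_symm_apply] at this
  exact this.symm

theorem not_joinsThrough_bridge (h : ¬ GlueJoinsThrough c b) :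
    ¬ JoinsThrough (bridge φ) c := by
  rintro ⟨r, s, hrs, hr, hs, hR⟩
  obtain ⟨i, hi⟩ := bridge_right_left φ h hr
  exact leftPt_ne_rightPt i s <| concat_three_ends (bridge φ) c (capInv_id_rightPt_eq.2 hr)
    (capInv_id_rightPt_eq.2 hs) (by simp) hR hi (mt rightPt_inj.1 hrs.symm)
    (leftPt_ne_rightPt _ _)

theorem isProduct_bridge (h : ¬ GlueJoinsThrough c b) : IsProduct (bridge φ) c a := by
  intro i j hij
  have hpair (hi : a.partner i ≠ i) :
      (concat (bridge φ) c).Reachable (leftPt i) (leftPt (a.partner i)) := by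
    rw [← bridgeFun_leftPt_of_ne φ hi]
    exact concat_reachable_partner (bridge φ) c _
  constructor
  · rintro rfl
    exact hpair hij.symm
  · intro hR
    by_cases hi : a.partner i = i
    · obtain ⟨r, hr, hsr⟩ := (card_through_le_of_not_glueJoinsThrough h).2 _ (φ ⟨i, hi⟩).2
      have hir := (bridge_reachable_through (c := c) φ ⟨i, hi⟩).trans
        (bridge_reachable_of_glue φ hsr)
      exact absurd (concat_three_ends (bridge φ) c (by simp) (capInv_id_rightPt_eq.2 hr) (by simp)
        hir hR (leftPt_ne_rightPt _ _).symm (mt leftPt_inj.1 hij.symm)) (leftPt_ne_rightPt _ _)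
    · exact concat_three_left (bridge φ) c hR (hpair hi) hij.symm hi

/-- A gluing component without through-strings never uses a strand crossing the bridge, so it
remains a closed loop on the right side; every loop arises in this way. -/
theorem concatLoops_bridge : concatLoops (bridge φ) c = glueLoops c b := by
  symm
  have hclosed {x : Fin n} {z : Fin (2 * n)}
      (hx : ∀ i ∈ ((glue c b).connectedComponentMk x).supp, ¬ c.IsThrough i ∧ ¬ b.IsThrough i)
      (hz : (concat (bridge φ) c).Reachable (rightPt x) z) :
      ∃ k, z = rightPt k ∧ (glue c b).Reachable x k := by
    refine concat_closed (P := fun z => ∃ k, z = rightPt k ∧ (glue c b).Reachable x k) ?_ ?_ hz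
      ⟨x, rfl, SimpleGraph.Reachable.refl _⟩
    · rintro _ ⟨k, rfl, hk⟩
      exact ⟨b.partner k, bridgeFun_rightPt_of_ne φ (hx k (mem_supp_mk.2 hk)).2,
        hk.trans (reachable_right _ _ k)⟩
    · rintro i ⟨k, hik, hk⟩
      obtain rfl := rightPt_inj.1 hik
      exact ⟨_, rfl, hk.trans (reachable_left _ _ i)⟩
  refine card_components_eq rightPt ?_ ?_ ?_
  · intro x y hx _
    refine ⟨bridge_reachable_of_glue φ, fun h => ?_⟩
    obtain ⟨k, hk, hxk⟩ := hclosed hx h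
    rwa [rightPt_inj.1 hk]
  · intro x hx i
    refine ⟨fun hm => ?_, fun ht hm => ?_⟩
    · obtain ⟨k, hk, -⟩ := hclosed hx (mem_supp_mk.1 hm)
      exact leftPt_ne_rightPt _ _ hk
    · obtain ⟨k, hk, hxk⟩ := hclosed hx (mem_supp_mk.1 hm)
      obtain rfl := rightPt_inj.1 hk
      exact (hx i (mem_supp_mk.2 hxk)).1 ht
  · intro w hw
    rcases leftPt_or_rightPt w with ⟨k, rfl⟩ | ⟨k, rfl⟩
    · exact absurd (mem_supp_mk.2 (SimpleGraph.Reachable.refl _)) (hw k).1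
    · refine ⟨k, fun i hi => ?_, SimpleGraph.Reachable.refl _⟩
      have hR := bridge_reachable_of_glue φ (mem_supp_mk.1 hi)
      refine ⟨fun ht => (hw i).2 ht (mem_supp_mk.2 hR), fun ht => ?_⟩
      have := bridge_reachable_through (c := c) φ (φ.symm ⟨i, ht⟩)
      rw [OrderIso.apply_symm_apply] at this
      exact (hw _).1 (mem_supp_mk.2 (hR.trans this.symm))

/-- The diagram `bridge φ` acts on `U(n; p)` for small `p` as a rank one operator. -/
theorem actBasis_bridge (q : ℝ) (hle : c.numPairs ≤ b.numPairs) :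
    actBasis q (bridge φ) c = formBasis q c b • xi a := by
  by_cases h : GlueJoinsThrough c b
  · rw [actBasis_of_joinsThrough q (joinsThrough_bridge φ hle h), formBasis, if_pos h, zero_smul]
  · rw [actBasis_of_isProduct q (not_joinsThrough_bridge φ h) (isProduct_bridge φ h),
      concatLoops_bridge, formBasis, if_neg h]

end Bridge

/-! ### Uniqueness of the form -/

theorem exists_through_orderIso {a b : HalfDiagram n} (h : a.numPairs = b.numPairs) :
    Nonempty ({i // a.partner i = i} ≃o {i // b.partner i = i}) := by
  have hcard : Fintype.card {i // b.partner i = i} = Fintype.card {i // a.partner i = i} := by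
    have := two_mul_numPairs_add a
    have := two_mul_numPairs_add b
    rw [← Nat.card_eq_fintype_card, ← Nat.card_eq_fintype_card]
    omega
  exact ⟨(Fintype.orderIsoFinOfCardEq _ rfl).symm.trans (Fintype.orderIsoFinOfCardEq _ hcard)⟩

/-- In the gluing of `a` with itself each through-string is an isolated point, so the value is a
power of `q`. -/
theorem formBasis_self_ne_zero {q : ℝ} (hq : 0 < q) (a : HalfDiagram n) :
    formBasis q a a ≠ 0 := by
  have h : ¬ GlueJoinsThrough a a := by
    rintro ⟨i, j, hij, hR, hi⟩
    have hi : a.partner i = i := by rcases hi with h | h <;> exact h.1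
    refine hij (glue_closed (P := fun k => i = k) ?_ ?_ hR rfl) <;>
    · rintro _ rfl; exact hi.symm
  rw [formBasis, if_neg h]
  exact pow_ne_zero _ (Complex.ofReal_ne_zero.2 hq.ne')

/-- The bridge from `a` to itself is its own transpose; moving it across `B` compares its actions on
`ξ_a` and `ξ_c`. -/
theorem IsStarAdjoint.apply_of_numPairs_le {q : ℝ} {B : SesqForm n} (hB : IsStarAdjoint q B)
    {a c : HalfDiagram n} (hle : c.numPairs ≤ a.numPairs) :
    formBasis q a a * B (xi a) (xi c) = formBasis q c a * B (xi a) (xi a) ∧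
    formBasis q a a * B (xi c) (xi a) = formBasis q c a * B (xi a) (xi a) := by
  rw [isStarAdjoint_iff] at hB
  set φ := OrderIso.refl {i // a.partner i = i} with hφ
  have ht : (bridge φ).transpose = bridge φ := bridge_transpose φ
  constructor
  · have := hB (bridge φ) a c
    rw [ht, actBasis_bridge φ q le_rfl, actBasis_bridge φ q hle] at this
    simpa only [map_smul, LinearMap.map_smulₛₗ, LinearMap.smul_apply, smul_eq_mul, conj_formBasis]
      using this
  · have := hB (bridge φ) c a
    rw [ht, actBasis_bridge φ q le_rfl, actBasis_bridge φ q hle] at this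
    simpa only [map_smul, LinearMap.map_smulₛₗ, LinearMap.smul_apply, smul_eq_mul, conj_formBasis]
      using this.symm

/-- The bridge with `a` on the left and `b` on the right carries `ξ_b` to a multiple of `ξ_a`, and
its transpose does the reverse. -/
theorem IsStarAdjoint.apply_self {q : ℝ} {B : SesqForm n} (hB : IsStarAdjoint q B)
    {a b : HalfDiagram n} (h : a.numPairs = b.numPairs) :
    formBasis q b b * B (xi a) (xi a) = formBasis q a a * B (xi b) (xi b) := by
  rw [isStarAdjoint_iff] at hB
  obtain ⟨φ⟩ := exists_through_orderIso h
  have := hB (bridge φ) b a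
  rw [bridge_transpose, actBasis_bridge φ q le_rfl, actBasis_bridge φ.symm q le_rfl] at this
  simpa only [map_smul, LinearMap.map_smulₛₗ, LinearMap.smul_apply, smul_eq_mul, conj_formBasis]
      using this

theorem eq_mul_on_UPairs {B D : SesqForm n} {p p' : ℕ} {s : ℂ}
    (h : ∀ a b : HalfDiagram n, a.numPairs = p → b.numPairs = p' →
      B (xi a) (xi b) = s * D (xi a) (xi b)) :
    ∀ x ∈ UPairs n p, ∀ y ∈ UPairs n p', B x y = s * D x y := by
  intro x hx y hy
  induction hx using Submodule.span_induction with
  | zero => simp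
  | add x x' _ _ hx hx' => simp [hx, hx', mul_add]
  | smul t x _ hx => simp only [map_smul, LinearMap.smul_apply, hx, smul_eq_mul]; ring
  | mem x hx =>
    obtain ⟨a, ha, rfl⟩ := hx
    induction hy using Submodule.span_induction with
    | zero => simp
    | add y y' _ _ hy hy' => simp [hy, hy', mul_add]
    | smul t y _ hy => simp only [LinearMap.map_smulₛₗ, hy, smul_eq_mul]; ring
    | mem y hy =>
      obtain ⟨b, hb, rfl⟩ := hy
      exact h a b ha hb

theorem xi_mem_UPairs (a : HalfDiagram n) : xi a ∈ UPairs n a.numPairs :=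
  Submodule.subset_span ⟨a, rfl, rfl⟩

theorem actBasis_mem_UPairs (q : ℝ) (d : Diagram n) (a : HalfDiagram n) :
    actBasis q d a ∈ UPairs n a.numPairs := by
  by_cases hJ : JoinsThrough d a
  · rw [actBasis_of_joinsThrough q hJ]; exact zero_mem _
  · obtain ⟨b, hb⟩ := exists_isProduct d a
    rw [actBasis_of_isProduct q hJ hb, ← hb.numPairs_eq hJ]
    exact Submodule.smul_mem _ _ (xi_mem_UPairs b)

end TemperleyLieb

end

theorem mainTheorem4 (n : ℕ) (q : ℝ) (hq : 0 < q) :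
    TemperleyLieb.IsStarAdjoint q (TemperleyLieb.diagramForm n q) ∧
    ∀ B : TemperleyLieb.SesqForm n,
      TemperleyLieb.IsStarAdjoint q B ↔
        (∀ p p' : ℕ, p ≠ p' →
          ∀ x ∈ TemperleyLieb.UPairs n p, ∀ y ∈ TemperleyLieb.UPairs n p', B x y = 0) ∧
        (∀ p : ℕ, ∃ c : ℂ,
          ∀ x ∈ TemperleyLieb.UPairs n p, ∀ y ∈ TemperleyLieb.UPairs n p,
            B x y = c * TemperleyLieb.diagramForm n q x y) := by
  open TemperleyLieb in
  refine ⟨isStarAdjoint_diagramForm q, fun B => ⟨fun hB => ⟨?_, ?_⟩, ?_⟩⟩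
  · intro p p' hp x hx y hy
    -- The scalar 0 turns the extension from basis vectors into a vanishing statement; the choice of
    -- `D` is immaterial.
    rw [eq_mul_on_UPairs (B := B) (D := B) (s := 0) ?_ x hx y hy, zero_mul]
    rintro a b rfl rfl
    rw [zero_mul]
    rcases le_total b.numPairs a.numPairs with hle | hle
    · have := (hB.apply_of_numPairs_le hle).1
      rw [formBasis_eq_zero q hp.symm, zero_mul] at this
      exact (mul_eq_zero.1 this).resolve_left (formBasis_self_ne_zero hq a)
    · have := (hB.apply_of_numPairs_le hle).2
      rw [formBasis_eq_zero q hp, zero_mul] at this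
      exact (mul_eq_zero.1 this).resolve_left (formBasis_self_ne_zero hq b)
  · intro p
    by_cases hex : ∃ b : HalfDiagram n, b.numPairs = p
    · obtain ⟨b, rfl⟩ := hex
      -- The scalar is forced by evaluating at the pair `ξ_b, ξ_b`; by `apply_self` any other `b`
      -- with as many pairs gives the same one.
      refine ⟨B (xi b) (xi b) / formBasis q b b, eq_mul_on_UPairs ?_⟩
      intro a c ha hc
      have h1 := (hB.apply_of_numPairs_le (hc.trans ha.symm).le).1
      have h2 := hB.apply_self ha
      have ha0 := formBasis_self_ne_zero hq a
      have hb0 := formBasis_self_ne_zero hq b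
      rw [diagramForm_xi, formBasis_comm q a c]
      rw [div_mul_eq_mul_div, eq_div_iff hb0]
      refine mul_left_cancel₀ ha0 ?_
      linear_combination formBasis q b b * h1 + formBasis q c a * h2
    -- Without half-diagrams with `p` pairs, `U(n; p)` is zero and any scalar serves.
    · exact ⟨0, eq_mul_on_UPairs fun a _ ha => absurd ⟨a, ha⟩ hex⟩
  · rintro ⟨h1, h2⟩
    rw [isStarAdjoint_iff]
    intro d a b
    by_cases hab : a.numPairs = b.numPairs
    · obtain ⟨c, hc⟩ := h2 a.numPairs
      rw [hc _ (actBasis_mem_UPairs q d a) _ (hab ▸ xi_mem_UPairs b),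
        hc _ (xi_mem_UPairs a) _ (hab ▸ actBasis_mem_UPairs q d.transpose b),
        (isStarAdjoint_iff q _).1 (isStarAdjoint_diagramForm q)]
    · rw [h1 _ _ hab _ (actBasis_mem_UPairs q d a) _ (xi_mem_UPairs b),
        h1 _ _ hab _ (xi_mem_UPairs a) _ (actBasis_mem_UPairs q d.transpose b)]
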